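/- Let $d\ge 0$ and let $(G,\sigma)$, $(G',\sigma')$ be two $U(d)$-connection graphs: $G=(V,w,\mu)$ is a locally finite weighted graph with symmetric edge weights $w_{xy}=w_{yx}\ge 0$, $w_{xx}=0$ (and $x\sim y$ iff $w_{xy}\ne0$), vertex measure $\mu>0$, and unitary matrices $\sigma_{xy}\in U(d)$ with $\sigma_{xy}=\sigma_{yx}^{-1}$ for $x\sim y$; similarly $G'=(V',w',\mu')$. **Notation.** Put $p_{xy}=w_{xy}/\mu_x$, $\Delta h(x)=\sum_{y\sim x}p_{xy}(h(y)-h(x))$ for $h:V\to\mathbb C$, and, for $f,g:V\to\mathbb C^d$, $$\Delta^\sigma f(x)=\sum_{y\sim x}p_{xy}(\sigma_{xy}f(y)-f(x)),\qquad 2\Gamma^\sigma(f,g)=\Delta(f^\top\overline g)-f^\top\overline{\Delta^\sigma g}-(\Delta^\sigma f)^\top\overline g,$$ $$2\Gamma_2^\sigma(f,g)=\Delta\Gamma^\sigma(f,g)-\Gamma^\sigma(f,\Delta^\sigma g)-\Gamma^\sigma(\Delta^\sigma f,g).$$ Fix $x\in V$, and let $S_r(x)$, $B_r(x)$ be the sphere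 and ball of radius $r$ in the graph distance, $S_1(x)=\{y_1,\dots,y_m\}$. Let $\Gamma_2^\sigma(x)$ be the matrix of the sesquilinear form $(f,g)\mapsto\Gamma_2^\sigma(f,g)(x)$ (so that the form is $f^\top\Gamma_2^\sigma(x)\overline g$), and let $$Q(x)=\Gamma_2^\sigma(x)_{B_1,B_1}-\Gamma_2^\sigma(x)_{B_1,S_2}\,\Gamma_2^\sigma(x)_{S_2,S_2}^{-1}\,\Gamma_2^\sigma(x)_{S_2,B_1}$$ with $B_1=B_1(x)$ and $S_2=S_2(x)$. Let $$B_0=\begin{pmatrix} I_d&\overline{\sigma_{xy_1}}&\cdots&\overline{\sigma_{xy_m}}\\&p_{xy_1}^{-1/2}I_d&&\\&&\ddots&\\&&&p_{xy_m}^{-1/2}I_d\end{pmatrix},\qquad 2B_0Q(x)\overline{B_0}^\top=\begin{pmatrix}a&\omega^\top\\ \overline\omega& M\end{pmatrix},\qquad A_\infty(x)=M-\overline\omega\,a^\dagger\omega^\top,$$ where $a$ is $d\times d$, $M$ is $md\times md$, and $\dagger$ is the Moore–Penrose pseudoinverse. Let $a',\omega',A_\infty(x')$ be the corresponding matrices of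 $(G',\sigma')$ at $x'\in V'$. The signature group $\Sigma$ of $(G,\sigma)$ is the subgroup of $U(d)$ generated by all $\sigma_{xy}$, $x\sim y$; $\Sigma'$ is that of $(G',\sigma')$. A connection graph is balanced if the ordered product of the connections along every cycle is $I_d$. $B_2^{inc}(x)$ is the connection graph obtained from the induced subgraph on $B_2(x)$ by deleting the edges between vertices of $S_2(x)$, with the restricted connection. For $\alpha,\beta>0$ the Cartesian product $(G,\sigma)\times_{\alpha,\beta}(G',\sigma')$ is the connection graph on $V\times V'$ with measure $\mu_x\mu'_{x'}$, edge weights $w_{(x,x')(y,x')}=\alpha w_{xy}\mu'_{x'}$ and $w_{(x,x')(x,y')}=\beta w'_{x'y'}\mu_x$ (all others $0$), and connection $\sigma^\times_{(x,x')(y,x')}=\sigma_{xy}$, $\sigma^\times_{(x,x')(x,y')}=\sigma'_{x'y'}$. Its matrix $A_\infty$ at $(x,x')$, formed in the same way, is denoted $A_\infty(x,x')$, with $S_1((x,x'))=(S_1(x)\times\{x'\})\sqcup(\{x\}\times S_1(x'))$ ordered accordingly. **Theorem.** Suppose that $\Sigma$ and $\Sigma'$ commute, i.e. $gg'=g'g$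 for all $g\in\Sigma$, $g'\in\Sigma'$, and let $\alpha,\beta>0$. Then for all $x\in V$ and $x'\in V'$, $$A_\infty(x,x')=\begin{pmatrix}\alpha A_\infty(x)&\\&\beta A_\infty(x')\end{pmatrix}+R(x,x'),$$ where $$R(x,x')=\begin{pmatrix}\alpha^{3}\overline{\omega}\left((\alpha^2a)^{\dagger}-(\alpha^2a+\beta^2a')^{\dagger}\right)\omega^{\top}&-\alpha^{3/2}\beta^{3/2}\,\overline{\omega}(\alpha^2a+\beta^2a')^{\dagger}\omega'^{\top}\\-\alpha^{3/2}\beta^{3/2}\,\overline{\omega'}(\alpha^2a+\beta^2a')^{\dagger}\omega^{\top}&\beta^{3}\overline{\omega'}\left((\beta^2a')^{\dagger}-(\alpha^2a+\beta^2a')^{\dagger}\right)\omega'^{\top}\end{pmatrix}$$ is positive semidefinite. Moreover, if $B_2^{inc}(x)$ or $B_2^{inc}(x')$ is balanced, then $R(x,x')=\mathbf 0$. -/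

import Mathlib

open scoped ComplexOrder Matrix

/-! ### The Moore-Penrose pseudoinverse of a complex matrix -/

/-- `X` is a Moore-Penrose pseudoinverse of `A`: the four Penrose equations. -/
structure IsPseudoinverse {m n : Type*} [Fintype m] [Fintype n]
    (A : Matrix m n ℂ) (X : Matrix n m ℂ) : Prop where
  mul_mul_self : A * X * A = A
  mul_mul_inv : X * A * X = X
  left_herm : (A * X)ᴴ = A * X
  right_herm : (X * A)ᴴ = X * A

theorem IsPseudoinverse.unique {m n : Type*} [Fintype m] [Fintype n]
    {A : Matrix m n ℂ} {X Y : Matrix n m ℂ}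
    (hX : IsPseudoinverse A X) (hY : IsPseudoinverse A Y) : X = Y := by
  have h1 : A * X = A * Y := by
    calc A * X = (A * X)ᴴ := hX.left_herm.symm
      _ = ((A * Y) * (A * X))ᴴ := by
        rw [← Matrix.mul_assoc (A * Y) A X, hY.mul_mul_self]
      _ = (A * X) * (A * Y) := by
        rw [Matrix.conjTranspose_mul, hX.left_herm, hY.left_herm]
      _ = A * Y := by rw [← Matrix.mul_assoc (A * X) A Y, hX.mul_mul_self]
  have h2 : X * A = Y * A := by
    calc X * A = (X * A)ᴴ := hX.right_herm.symm
      _ = ((X * A) * (Y * A))ᴴ := by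
        rw [Matrix.mul_assoc X A (Y * A), ← Matrix.mul_assoc A Y A, hY.mul_mul_self]
      _ = (Y * A) * (X * A) := by
        rw [Matrix.conjTranspose_mul, hX.right_herm, hY.right_herm]
      _ = Y * A := by
        rw [Matrix.mul_assoc Y A (X * A), ← Matrix.mul_assoc A X A, hX.mul_mul_self]
  calc X = X * A * X := hX.mul_mul_inv.symm
    _ = Y * A * Y := by rw [h2, Matrix.mul_assoc, h1, ← Matrix.mul_assoc]
    _ = Y := hY.mul_mul_inv

theorem exists_isPseudoinverse_of_isHermitian {n : Type*} [Fintype n] [DecidableEq n]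
    {A : Matrix n n ℂ} (hA : A.IsHermitian) :
    ∃ X, IsPseudoinverse A X ∧ X.IsHermitian := by
  obtain ⟨U, D, hU, hAe⟩ : ∃ (U : Matrix n n ℂ) (D : n → ℝ),
      Uᴴ * U = 1 ∧ A = U * Matrix.diagonal (fun i => (D i : ℂ)) * Uᴴ := by
    refine ⟨hA.eigenvectorUnitary, hA.eigenvalues, ?_, ?_⟩
    · exact (Matrix.mem_unitaryGroup_iff').1 hA.eigenvectorUnitary.2
    · have h := hA.spectral_theorem
      rw [Unitary.conjStarAlgAut_apply] at h
      exact h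
  have key : ∀ f g : n → ℂ,
      (U * Matrix.diagonal f * Uᴴ) * (U * Matrix.diagonal g * Uᴴ)
        = U * Matrix.diagonal (fun i => f i * g i) * Uᴴ := by
    intro f g
    calc _ = U * Matrix.diagonal f * (Uᴴ * U) * Matrix.diagonal g * Uᴴ := by
          simp only [Matrix.mul_assoc]
      _ = _ := by
          rw [hU, Matrix.mul_one, Matrix.mul_assoc U, Matrix.diagonal_mul_diagonal]
  have herm : ∀ f : n → ℝ,
      (U * Matrix.diagonal (fun i => (f i : ℂ)) * Uᴴ)ᴴ
        = U * Matrix.diagonal (fun i => (f i : ℂ)) * Uᴴ := by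
    intro f
    rw [Matrix.conjTranspose_mul, Matrix.conjTranspose_mul, Matrix.conjTranspose_conjTranspose,
      Matrix.diagonal_conjTranspose, Matrix.mul_assoc]
    congr 3
    ext i
    simp
  refine ⟨U * Matrix.diagonal (fun i => (((D i)⁻¹ : ℝ) : ℂ)) * Uᴴ, ⟨?_, ?_, ?_, ?_⟩, herm _⟩
  · rw [hAe, key, key]
    congr 3
    ext i
    by_cases h : D i = 0 <;> simp [h]
  · rw [hAe, key, key]
    congr 3
    ext i
    by_cases h : D i = 0 <;> simp [h]
  · rw [hAe, key]
    have := herm (fun i => D i * (D i)⁻¹)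
    simpa using this
  · rw [hAe, key]
    have := herm (fun i => (D i)⁻¹ * D i)
    simpa using this

theorem exists_isPseudoinverse {m n : Type*} [Fintype m] [Fintype n]
    (A : Matrix m n ℂ) : ∃ X, IsPseudoinverse A X := by
  classical
  obtain ⟨Y, hY, hYh⟩ := exists_isPseudoinverse_of_isHermitian
    (Matrix.isHermitian_conjTranspose_mul_self A)
  have hYe : Yᴴ = Y := hYh
  have h1 : A * Y * (Aᴴ * A) = A := by
    have h0 : (A * Y * (Aᴴ * A) - A)ᴴ * (A * Y * (Aᴴ * A) - A) = 0 := by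
      have e : A * Y * (Aᴴ * A) - A = A * (Y * (Aᴴ * A) - 1) := by
        rw [Matrix.mul_sub, Matrix.mul_one, Matrix.mul_assoc]
      have e2 : Aᴴ * (A * (Y * (Aᴴ * A) - 1)) = 0 := by
        rw [← Matrix.mul_assoc, Matrix.mul_sub, Matrix.mul_one, ← Matrix.mul_assoc,
          hY.mul_mul_self, sub_self]
      rw [e, Matrix.conjTranspose_mul, Matrix.mul_assoc, e2, Matrix.mul_zero]
    exact sub_eq_zero.1 (Matrix.conjTranspose_mul_self_eq_zero.1 h0)
  refine ⟨Y * Aᴴ, ⟨?_, ?_, ?_, ?_⟩⟩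
  · simpa only [Matrix.mul_assoc] using h1
  · have := hY.mul_mul_inv
    calc Y * Aᴴ * A * (Y * Aᴴ) = (Y * (Aᴴ * A) * Y) * Aᴴ := by simp only [Matrix.mul_assoc]
      _ = Y * Aᴴ := by rw [this]
  · simp only [Matrix.conjTranspose_mul, Matrix.conjTranspose_conjTranspose, hYe,
      Matrix.mul_assoc]
  · simpa only [Matrix.mul_assoc] using hY.right_herm

/-- The Moore-Penrose pseudoinverse `A†`. -/
noncomputable def pinv {m n : Type*} [Fintype m] [Fintype n] (A : Matrix m n ℂ) :
    Matrix n m ℂ :=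
  (exists_isPseudoinverse A).choose

theorem pinv_spec {m n : Type*} [Fintype m] [Fintype n] (A : Matrix m n ℂ) :
    IsPseudoinverse A (pinv A) :=
  (exists_isPseudoinverse A).choose_spec

/-! ### Connection graphs -/

/-- A locally finite weighted graph with vertex measure `μ`, symmetric edge weight `w` (two
vertices are adjacent iff `w x y ≠ 0`) and `U(d)`-valued connection `σ` on oriented edges.  The
values of `σ x y` for non-adjacent `x, y` carry no information and are never used. -/
structure ConnectionGraph (V : Type*) (d : ℕ) where
  w : V → V → ℝ
  μ : V → ℝ
  σ : V → V → Matrix.unitaryGroup (Fin d) ℂ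
  w_nonneg : ∀ x y, 0 ≤ w x y
  w_symm : ∀ x y, w x y = w y x
  w_self : ∀ x, w x x = 0
  μ_pos : ∀ x, 0 < μ x
  locallyFinite : ∀ x, {y | w x y ≠ 0}.Finite
  σ_inv : ∀ x y, w x y ≠ 0 → σ x y = (σ y x)⁻¹

namespace ConnectionGraph

variable {V : Type*} {d : ℕ} (G : ConnectionGraph V d)

/-- The underlying simple graph. -/
def graph : SimpleGraph V where
  Adj x y := G.w x y ≠ 0
  symm := ⟨fun x y h => by rwa [G.w_symm y x]⟩
  loopless := ⟨fun x h => h (G.w_self x)⟩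

/-- The finite set of neighbours of `x`. -/
noncomputable def nbr (x : V) : Finset V := (G.locallyFinite x).toFinset

/-- The transition rate `p_{xy} = w_{xy} / μ_x`. -/
noncomputable def p (x y : V) : ℝ := G.w x y / G.μ x

/-- The sphere `S_r(x)` for the (extended) graph distance. -/
def sphere (x : V) (r : ℕ) : Set V := {y | G.graph.edist x y = r}

/-- The closed ball `B_r(x)` for the (extended) graph distance. -/
def closedBall (x : V) (r : ℕ) : Set V := {y | G.graph.edist x y ≤ r}

theorem mem_sphere_one {x y : V} : y ∈ G.sphere x 1 ↔ G.w x y ≠ 0 := by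
  have h : G.graph.edist x y = 1 ↔ G.graph.Adj x y := SimpleGraph.edist_eq_one_iff_adj
  exact h

theorem finite_closedBall (x : V) (r : ℕ) : (G.closedBall x r).Finite := by
  induction r generalizing x with
  | zero =>
    refine (Set.finite_singleton x).subset fun y hy => ?_
    have h0 : G.graph.edist x y = 0 := nonpos_iff_eq_zero.1 hy
    exact (SimpleGraph.edist_eq_zero_iff.1 h0).symm
  | succ r ih =>
    refine ((Set.finite_singleton x).union
      ((G.locallyFinite x).biUnion fun y _ => ih y)).subset fun z hz => ?_
    have hz' : G.graph.edist x z ≤ ((r + 1 : ℕ) : ℕ∞) := hz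
    have hr : G.graph.Reachable x z := SimpleGraph.reachable_of_edist_ne_top
      (ne_top_of_le_ne_top (ENat.natCast_ne_top _) hz')
    obtain ⟨q, hq⟩ := hr.exists_walk_length_eq_edist
    cases q with
    | nil => exact Or.inl rfl
    | @cons _ y _ h q =>
      refine Or.inr (Set.mem_biUnion (x := y) h ?_)
      refine (SimpleGraph.edist_le q).trans ?_
      rw [← hq] at hz'
      have : q.length + 1 ≤ r + 1 := by exact_mod_cast hz'
      exact_mod_cast Nat.le_of_succ_le_succ this

theorem sphere_subset_closedBall (x : V) (r : ℕ) : G.sphere x r ⊆ G.closedBall x r :=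
  fun _ hy => le_of_eq hy

noncomputable instance instFintypeSphere (x : V) (r : ℕ) : Fintype (G.sphere x r) :=
  ((G.finite_closedBall x r).subset (G.sphere_subset_closedBall x r)).fintype

/-! ### Laplacians and the `Γ`-calculus -/

/-- The graph Laplacian `Δ` on scalar functions. -/
noncomputable def lap (h : V → ℂ) (x : V) : ℂ :=
  ∑ y ∈ G.nbr x, (G.p x y : ℂ) * (h y - h x)

/-- The connection Laplacian `Δ^σ` on vector valued functions. -/
noncomputable def connLap (f : V → Fin d → ℂ) (x : V) : Fin d → ℂ :=
  ∑ y ∈ G.nbr x, (G.p x y : ℂ) • ((G.σ x y : Matrix (Fin d) (Fin d) ℂ) *ᵥ f y - f x)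

/-- `2 Γ^σ(f,g) = Δ(fᵀ ḡ) - fᵀ conj(Δ^σ g) - (Δ^σ f)ᵀ ḡ`. -/
noncomputable def Gam (f g : V → Fin d → ℂ) (x : V) : ℂ :=
  (1 / 2 : ℂ) * (G.lap (fun y => f y ⬝ᵥ star (g y)) x
    - f x ⬝ᵥ star (G.connLap g x) - G.connLap f x ⬝ᵥ star (g x))

/-- `2 Γ₂^σ(f,g) = Δ(Γ^σ(f,g)) - Γ^σ(f, Δ^σ g) - Γ^σ(Δ^σ f, g)`. -/
noncomputable def Gam2 (f g : V → Fin d → ℂ) (x : V) : ℂ :=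
  (1 / 2 : ℂ) * (G.lap (G.Gam f g) x
    - G.Gam f (G.connLap g) x - G.Gam (G.connLap f) g x)

open Classical in
/-- The function `V → ℂ^d` equal to the `i`-th standard vector at `u` and to `0` elsewhere. -/
noncomputable def basisFun (q : V × Fin d) : V → Fin d → ℂ :=
  Pi.single q.1 (Pi.single q.2 1)

/-- The matrix of the sesquilinear form `(f, g) ↦ Γ₂^σ(f,g)(x)`, i.e. the matrix `M` with
`Γ₂^σ(f,g)(x) = fᵀ M ḡ`. -/
noncomputable def Gam2Matrix (x : V) : Matrix (V × Fin d) (V × Fin d) ℂ :=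
  fun q q' => G.Gam2 (basisFun q) (basisFun q') x

/-! ### The curvature matrix -/

/-- Index type of the block of `S_1(x)`. -/
abbrev Idx1 (x : V) : Type _ := G.sphere x 1 × Fin d

/-- Index type of the block of `B_1(x) = {x} ∪ S_1(x)`. -/
abbrev IdxB (x : V) : Type _ := Fin d ⊕ G.Idx1 x

/-- Index type of the block of `S_2(x)`. -/
abbrev Idx2 (x : V) : Type _ := G.sphere x 2 × Fin d

def embB (x : V) : G.IdxB x → V × Fin d :=
  Sum.elim (fun i => (x, i)) (fun q => (q.1.1, q.2))

def emb2 (x : V) : G.Idx2 x → V × Fin d := fun q => (q.1.1, q.2)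

open Classical in
/-- The Schur complement `Q(x)` of the `(S_2,S_2)`-block in `Γ₂^σ(x)`. -/
noncomputable def Q (x : V) : Matrix (G.IdxB x) (G.IdxB x) ℂ :=
  (G.Gam2Matrix x).submatrix (G.embB x) (G.embB x)
    - (G.Gam2Matrix x).submatrix (G.embB x) (G.emb2 x)
      * ((G.Gam2Matrix x).submatrix (G.emb2 x) (G.emb2 x))⁻¹
      * (G.Gam2Matrix x).submatrix (G.emb2 x) (G.embB x)

/-- `2 B Q(x) B̄ᵀ`. -/
noncomputable def twoBQB (x : V) (B : Matrix (G.IdxB x) (G.IdxB x) ℂ) :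
    Matrix (G.IdxB x) (G.IdxB x) ℂ :=
  (2 : ℂ) • (B * G.Q x * Bᴴ)

/-- The `d × d` block `a(G,σ,x,B)`. -/
noncomputable def a (x : V) (B : Matrix (G.IdxB x) (G.IdxB x) ℂ) : Matrix (Fin d) (Fin d) ℂ :=
  (G.twoBQB x B).toBlocks₁₁

/-- `ω(G,σ,x,B)`; its transpose `ωᵀ` is the upper right block of `2 B Q(x) B̄ᵀ`. -/
noncomputable def omega (x : V) (B : Matrix (G.IdxB x) (G.IdxB x) ℂ) :
    Matrix (G.Idx1 x) (Fin d) ℂ :=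
  (G.twoBQB x B).toBlocks₁₂ᵀ

/-- The curvature matrix `A_∞(G,σ,x,B)`. -/
noncomputable def curvatureMatrix (x : V) (B : Matrix (G.IdxB x) (G.IdxB x) ℂ) :
    Matrix (G.Idx1 x) (G.Idx1 x) ℂ :=
  (G.twoBQB x B).toBlocks₂₂
    - (G.omega x B).map star * pinv (G.a x B) * (G.omega x B)ᵀ

open Classical in
/-- The canonical choice `B_0` of the matrix `B`: first block row
`(I_d, conj σ_{xy_1}, …, conj σ_{xy_m})`, below it the diagonal blocks `p_{xy_i}^{-1/2} I_d`. -/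
noncomputable def canonicalB (x : V) : Matrix (G.IdxB x) (G.IdxB x) ℂ :=
  Matrix.fromBlocks 1 (Matrix.of fun i q => star ((G.σ x q.1.1).1 i q.2))
    0 (Matrix.diagonal fun q => (((1 / √(G.p x q.1.1) : ℝ)) : ℂ))

/-- `a` for the canonical choice `B_0`. -/
noncomputable def a₀ (x : V) : Matrix (Fin d) (Fin d) ℂ := G.a x (G.canonicalB x)

/-- `ω` for the canonical choice `B_0`. -/
noncomputable def omega₀ (x : V) : Matrix (G.Idx1 x) (Fin d) ℂ := G.omega x (G.canonicalB x)

/-- `A_∞(x) = A_∞(G,σ,x,B_0)`. -/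
noncomputable def A₀ (x : V) : Matrix (G.Idx1 x) (G.Idx1 x) ℂ :=
  G.curvatureMatrix x (G.canonicalB x)

/-! ### Signatures, balancedness, local structure -/

/-- The ordered product of the connection along a walk. -/
def walkSignature {u v : V} : G.graph.Walk u v → Matrix.unitaryGroup (Fin d) ℂ
  | .nil => 1
  | @SimpleGraph.Walk.cons _ _ u v _ _ q => G.σ u v * walkSignature q

/-- A connection graph is balanced if every cycle has trivial signature. -/
def Balanced : Prop :=
  ∀ (u : V) (q : G.graph.Walk u u), q.IsCycle → G.walkSignature q = 1

/-- The signature group: generated by the connections of all oriented edges. -/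
def signatureGroup : Subgroup (Matrix.unitaryGroup (Fin d) ℂ) :=
  Subgroup.closure {g | ∃ x y, G.w x y ≠ 0 ∧ g = G.σ x y}

open Classical in
/-- The local connection structure of the incomplete 2-ball `B_2^{inc}(x)`: the induced
connection graph on `B_2(x)` with the edges inside `S_2(x)` removed. -/
noncomputable def incBall (x : V) : ConnectionGraph (G.closedBall x 2) d where
  w u v := if u.1 ∈ G.sphere x 2 ∧ v.1 ∈ G.sphere x 2 then 0 else G.w u v
  μ u := G.μ u
  σ u v := G.σ u v
  w_nonneg u v := by
    split_ifs
    · exact le_rfl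
    · exact G.w_nonneg _ _
  w_symm u v := by
    rw [G.w_symm u v]
    simp only [and_comm]
  w_self u := by simp [G.w_self]
  μ_pos u := G.μ_pos _
  locallyFinite u := ((G.finite_closedBall x 2).preimage
    (f := Subtype.val) Subtype.val_injective.injOn).subset fun v _ => v.2
  σ_inv u v h := G.σ_inv _ _ fun h0 => h (by simp [h0])

/-! ### Cartesian products -/

section Product

variable {V' : Type*} (G' : ConnectionGraph V' d) (α β : ℝ)

open Classical in
/-- Edge weights of the weighted Cartesian product: `α w_{xy} μ_{x'}` between `(x,x')` and
`(y,x')`, `β w'_{x'y'} μ_x` between `(x,x')` and `(x,y')`, and `0` otherwise. -/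
noncomputable def prodWeight (u v : V × V') : ℝ :=
  (if u.2 = v.2 then α * G.w u.1 v.1 * G'.μ u.2 else 0)
    + (if u.1 = v.1 then β * G'.w u.2 v.2 * G.μ u.1 else 0)

theorem prodWeight_nonneg (hα : 0 < α) (hβ : 0 < β) (u v : V × V') :
    0 ≤ prodWeight G G' α β u v := by
  have h1 := mul_nonneg (mul_nonneg hα.le (G.w_nonneg u.1 v.1)) (G'.μ_pos u.2).le
  have h2 := mul_nonneg (mul_nonneg hβ.le (G'.w_nonneg u.2 v.2)) (G.μ_pos u.1).le
  unfold prodWeight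
  split_ifs <;> linarith

theorem prodWeight_left (x y : V) (x' : V') :
    prodWeight G G' α β (x, x') (y, x') = α * G.w x y * G'.μ x' := by
  simp [prodWeight, G'.w_self]

theorem prodWeight_right (x : V) (x' y' : V') :
    prodWeight G G' α β (x, x') (x, y') = β * G'.w x' y' * G.μ x := by
  simp [prodWeight, G.w_self]

/-- Adjacency in the Cartesian product. -/
theorem prodWeight_ne_zero (hα : 0 < α) (hβ : 0 < β) (u v : V × V') :
    prodWeight G G' α β u v ≠ 0 ↔
      (u.2 = v.2 ∧ G.w u.1 v.1 ≠ 0) ∨ (u.1 = v.1 ∧ G'.w u.2 v.2 ≠ 0) := by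
  obtain ⟨x, x'⟩ := u
  obtain ⟨y, y'⟩ := v
  have hμ := (G.μ_pos x).ne'
  have hμ' := (G'.μ_pos x').ne'
  by_cases h : x = y
  · subst h
    rw [prodWeight_right]
    simp [hβ.ne', hμ, G.w_self]
  · by_cases h' : x' = y'
    · subst h'
      rw [prodWeight_left]
      simp [hα.ne', hμ', G'.w_self]
    · simp [prodWeight, h, h']

open Classical in
/-- The Cartesian product `(G,σ) ×_{α,β} (G',σ')`. -/
noncomputable def prod (hα : 0 < α) (hβ : 0 < β) : ConnectionGraph (V × V') d where
  w := prodWeight G G' α β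
  μ u := G.μ u.1 * G'.μ u.2
  σ u v := if u.2 = v.2 then G.σ u.1 v.1 else G'.σ u.2 v.2
  w_nonneg := prodWeight_nonneg G G' α β hα hβ
  w_symm u v := by
    unfold prodWeight
    rw [G.w_symm u.1, G'.w_symm u.2]
    congr 1
    · by_cases h : u.2 = v.2
      · simp [h]
      · simp [h, Ne.symm h]
    · by_cases h : u.1 = v.1
      · simp [h]
      · simp [h, Ne.symm h]
  w_self u := by simp [prodWeight, G.w_self, G'.w_self]
  μ_pos u := mul_pos (G.μ_pos _) (G'.μ_pos _)
  locallyFinite u := by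
    refine (((G.locallyFinite u.1).prod (Set.finite_singleton u.2)).union
      ((Set.finite_singleton u.1).prod (G'.locallyFinite u.2))).subset fun v hv => ?_
    rcases (prodWeight_ne_zero G G' α β hα hβ u v).1 hv with ⟨h, h'⟩ | ⟨h, h'⟩
    · exact Or.inl ⟨h', h.symm⟩
    · exact Or.inr ⟨h.symm, h'⟩
  σ_inv u v huv := by
    rcases (prodWeight_ne_zero G G' α β hα hβ u v).1 huv with ⟨h, h'⟩ | ⟨h, h'⟩
    · simpa [h] using G.σ_inv _ _ h'
    · have hne : u.2 ≠ v.2 := fun e => h' (by rw [e, G'.w_self])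
      simpa [hne, Ne.symm hne] using G'.σ_inv _ _ h'

variable (hα : 0 < α) (hβ : 0 < β)

theorem mem_sphere_prod_left {x : V} {x' : V'} (y : G.sphere x 1) :
    ((y.1, x') : V × V') ∈ (G.prod G' α β hα hβ).sphere (x, x') 1 :=
  (mem_sphere_one _).2 ((prodWeight_ne_zero G G' α β hα hβ _ _).2
    (Or.inl ⟨rfl, G.mem_sphere_one.1 y.2⟩))

theorem mem_sphere_prod_right {x : V} {x' : V'} (y' : G'.sphere x' 1) :
    ((x, y'.1) : V × V') ∈ (G.prod G' α β hα hβ).sphere (x, x') 1 :=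
  (mem_sphere_one _).2 ((prodWeight_ne_zero G G' α β hα hβ _ _).2
    (Or.inr ⟨rfl, G'.mem_sphere_one.1 y'.2⟩))

/-- The map `S_1(x) ⊔ S_1(x') → S_1((x,x'))`, `y ↦ (y,x')`, `y' ↦ (x,y')`. -/
def sphereProdMap (x : V) (x' : V') :
    G.sphere x 1 ⊕ G'.sphere x' 1 → (G.prod G' α β hα hβ).sphere (x, x') 1 :=
  Sum.elim (fun y => ⟨(y.1, x'), mem_sphere_prod_left G G' α β hα hβ y⟩)
    (fun y' => ⟨(x, y'.1), mem_sphere_prod_right G G' α β hα hβ y'⟩)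

theorem sphereProdMap_bijective (x : V) (x' : V') :
    Function.Bijective (sphereProdMap G G' α β hα hβ x x') := by
  constructor
  · rintro (⟨y, hy⟩ | ⟨y, hy⟩) (⟨z, hz⟩ | ⟨z, hz⟩) h
    all_goals
      have h1 := congrArg (fun t => t.1.1) h
      have h2 := congrArg (fun t => t.1.2) h
      simp only [sphereProdMap, Sum.elim_inl, Sum.elim_inr] at h1 h2
    · subst h1; rfl
    · subst h1; exact absurd (G.w_self _) (G.mem_sphere_one.1 hy)
    · subst h1; exact absurd (G.w_self _) (G.mem_sphere_one.1 hz)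
    · subst h2; rfl
  · rintro ⟨⟨y, y'⟩, h⟩
    rcases (prodWeight_ne_zero G G' α β hα hβ _ _).1 ((mem_sphere_one _).1 h) with
      ⟨e, h'⟩ | ⟨e, h'⟩
    · obtain rfl : x' = y' := e
      exact ⟨Sum.inl ⟨y, G.mem_sphere_one.2 h'⟩, rfl⟩
    · obtain rfl : x = y := e
      exact ⟨Sum.inr ⟨y', G'.mem_sphere_one.2 h'⟩, rfl⟩

/-- The identification `S_1(x) ⊔ S_1(x') ≃ S_1((x,x'))`, on the level of block indices. -/
noncomputable def idxProdEquiv (x : V) (x' : V') :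
    G.Idx1 x ⊕ G'.Idx1 x' ≃ (G.prod G' α β hα hβ).Idx1 (x, x') :=
  (Equiv.sumProdDistrib (G.sphere x 1) (G'.sphere x' 1) (Fin d)).symm.trans
    ((Equiv.ofBijective _ (sphereProdMap_bijective G G' α β hα hβ x x')).prodCongr
      (Equiv.refl (Fin d)))

/-- The matrix `R(x,x')`. -/
noncomputable def remainder (x : V) (x' : V') :
    Matrix (G.Idx1 x ⊕ G'.Idx1 x') (G.Idx1 x ⊕ G'.Idx1 x') ℂ :=
  let a := G.a₀ x
  let a' := G'.a₀ x'
  let ω := G.omega₀ x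
  let ω' := G'.omega₀ x'
  let P := pinv (((α ^ 2 : ℝ) : ℂ) • a + ((β ^ 2 : ℝ) : ℂ) • a')
  let c : ℂ := ((α ^ (3 / 2 : ℝ) * β ^ (3 / 2 : ℝ) : ℝ) : ℂ)
  Matrix.fromBlocks
    (((α ^ 3 : ℝ) : ℂ) • (ω.map star * (pinv (((α ^ 2 : ℝ) : ℂ) • a) - P) * ωᵀ))
    (-(c • (ω.map star * P * ω'ᵀ)))
    (-(c • (ω'.map star * P * ωᵀ)))
    (((β ^ 3 : ℝ) : ℂ) • (ω'.map star * (pinv (((β ^ 2 : ℝ) : ℂ) • a') - P) * ω'ᵀ))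

end Product

end ConnectionGraph

/-! Everything reduces to one formula. By unitarity, `four_Gam2` writes `4Γ₂` at `x` as a weighted
sum of products of second covariant differences along two-step paths, corrected by terms that see
only `B_1(x)`. For `f` covariantly constant on `B_1(x)` the correction vanishes, so `Γ₂(f,f)` is a
sum of squares. Hence the `S_2` block is invertible and every function on `B_1` has a critical
extension to `S_2`. The Schur complement `Q` is `Γ₂` evaluated on such extensions
(`IsOptimalAt.Gam2_eq`), and conjugation by `B₀` takes the value at `x` and the rescaled edge
differences as coordinates (`dotProduct_twoBQB_mulVec`).

On the product, commuting signatures give `Γ₂^×` as the `α²`- and `β²`-weighted `Γ₂` of the two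
slices plus `αβ` times a form in the mixed differences (`Gam2_prod`). Two critical extensions with
the same centre value glue to a function without mixed differences, which is again critical
(`exists_isOptimalAt_prod`). So `2B₀QB₀ᴴ` of the product is a weighted sum of those of the factors:
`a` becomes `α²a + β²a'`, `ω` becomes the pair `α^{3/2}ω, β^{3/2}ω'`, and `M` becomes block diagonal
(`T₀_prod_blocks`).

The identity for `A_∞` is then algebra, and `R` is the gap between the Schur complement of a sum and
the sum of the Schur complements. It is positive semidefinite because the `a`'s are, and because the
kernel of `a` lies in that of `ωᵀ`, both acting on row vectors (`vecMul_toBlocks₁₂_eq_zero`). If an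
incomplete ball is balanced, every vector extends to a covariantly constant function there, so that
factor has `a = 0` and `ω = 0`, and `R` collapses. -/

namespace ConnectionGraph

/-! ### The `Γ`-calculus in terms of covariant differences -/

section Calculus

variable {V : Type*} {d : ℕ} (G : ConnectionGraph V d)

theorem mem_nbr {x y : V} : y ∈ G.nbr x ↔ G.w x y ≠ 0 := by
  simp [nbr]

theorem p_pos {x y : V} (h : y ∈ G.nbr x) : 0 < G.p x y :=
  div_pos (lt_of_le_of_ne (G.w_nonneg x y) (G.mem_nbr.1 h).symm) (G.μ_pos x)

/-- Parallel transport is isometric; this alone turns the `Γ`-calculus into sums over edges and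
two-step paths. -/
theorem dotProduct_star_unitary_mulVec (U : Matrix.unitaryGroup (Fin d) ℂ) (u v : Fin d → ℂ) :
    (U : Matrix (Fin d) (Fin d) ℂ) *ᵥ u ⬝ᵥ star ((U : Matrix (Fin d) (Fin d) ℂ) *ᵥ v)
      = u ⬝ᵥ star v := by
  have h : (U : Matrix (Fin d) (Fin d) ℂ)ᴴ * U = 1 := (Matrix.mem_unitaryGroup_iff').1 U.2
  have h2 : (U : Matrix (Fin d) (Fin d) ℂ)ᵀ *
      ((U : Matrix (Fin d) (Fin d) ℂ).map star) = 1 := by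
    have := congrArg Matrix.transpose h
    rw [Matrix.transpose_mul, Matrix.transpose_one] at this
    exact this
  have h3 : star ((U : Matrix (Fin d) (Fin d) ℂ) *ᵥ v)
      = (U : Matrix (Fin d) (Fin d) ℂ).map star *ᵥ star v := by
    rw [Matrix.star_mulVec, ← Matrix.mulVec_transpose]; rfl
  rw [h3, ← Matrix.vecMul_transpose, ← Matrix.dotProduct_mulVec, Matrix.mulVec_mulVec, h2,
    Matrix.one_mulVec]

/-- The covariant difference of `f` along the edge `x → y`. -/
def diff (f : V → Fin d → ℂ) (x y : V) : Fin d → ℂ :=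
  (G.σ x y : Matrix (Fin d) (Fin d) ℂ) *ᵥ f y - f x

/-- The second covariant difference of `f` along the path `x → y → z`. -/
def diff2 (f : V → Fin d → ℂ) (x y z : V) : Fin d → ℂ :=
  (G.σ x y : Matrix (Fin d) (Fin d) ℂ) *ᵥ G.diff f y z - G.diff f x y

theorem connLap_eq (f : V → Fin d → ℂ) (x : V) :
    G.connLap f x = ∑ y ∈ G.nbr x, (G.p x y : ℂ) • G.diff f x y := rfl

theorem star_connLap (f : V → Fin d → ℂ) (x : V) :
    star (G.connLap f x) = ∑ y ∈ G.nbr x, (G.p x y : ℂ) • star (G.diff f x y) := by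
  simp [connLap_eq, star_sum, star_smul]

theorem two_Gam (f g : V → Fin d → ℂ) (x : V) :
    2 * G.Gam f g x = ∑ y ∈ G.nbr x, (G.p x y : ℂ) * (G.diff f x y ⬝ᵥ star (G.diff g x y)) := by
  rw [Gam, ← mul_assoc, mul_one_div_cancel two_ne_zero, one_mul, star_connLap, connLap_eq, lap,
    dotProduct_sum, sum_dotProduct, ← Finset.sum_sub_distrib, ← Finset.sum_sub_distrib]
  refine Finset.sum_congr rfl fun y _ => ?_
  simp only [diff, star_sub, dotProduct_sub, sub_dotProduct, dotProduct_smul, smul_dotProduct,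
    smul_eq_mul, dotProduct_star_unitary_mulVec]
  ring

/-- The weighted degree `∑_y p_{xy}`. -/
noncomputable def deg (x : V) : ℂ := ∑ y ∈ G.nbr x, (G.p x y : ℂ)

/-- A Bochner-type identity, obtained by completing the square: at each neighbour `y`, the terms of
`Γ(f,g)(y)` and the transported Laplacians at `y` combine into second differences along `x → y → z`,
at the cost of a multiple of `deg y`. The Laplacians at `x` produce the last term. -/
theorem four_Gam2 (f g : V → Fin d → ℂ) (x : V) :
    4 * G.Gam2 f g x =
      ∑ y ∈ G.nbr x, (G.p x y : ℂ) * ∑ z ∈ G.nbr y, (G.p y z : ℂ) *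
          (G.diff2 f x y z ⬝ᵥ star (G.diff2 g x y z))
        - ∑ y ∈ G.nbr x, (G.p x y : ℂ) * ((G.deg x + G.deg y) *
          (G.diff f x y ⬝ᵥ star (G.diff g x y)))
        + 2 * (G.connLap f x ⬝ᵥ star (G.connLap g x)) := by
  have key : ∀ y, 2 * G.Gam f g y
      - (G.σ x y : Matrix (Fin d) (Fin d) ℂ) *ᵥ G.connLap f y ⬝ᵥ star (G.diff g x y)
      - G.diff f x y ⬝ᵥ star ((G.σ x y : Matrix (Fin d) (Fin d) ℂ) *ᵥ G.connLap g y)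
      = ∑ z ∈ G.nbr y, (G.p y z : ℂ) * (G.diff2 f x y z ⬝ᵥ star (G.diff2 g x y z))
        - G.deg y * (G.diff f x y ⬝ᵥ star (G.diff g x y)) := by
    intro y
    rw [two_Gam, deg, connLap_eq, connLap_eq, Matrix.mulVec_sum, Matrix.mulVec_sum, star_sum,
      dotProduct_sum, sum_dotProduct, Finset.sum_mul, ← Finset.sum_sub_distrib,
      ← Finset.sum_sub_distrib, ← Finset.sum_sub_distrib]
    refine Finset.sum_congr rfl fun z _ => ?_
    simp only [diff2, star_sub, dotProduct_sub, sub_dotProduct,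
      dotProduct_star_unitary_mulVec, Matrix.mulVec_smul, star_smul, smul_dotProduct,
      dotProduct_smul, smul_eq_mul, RCLike.star_def, Complex.conj_ofReal]
    ring
  have h1 : 4 * G.Gam2 f g x = G.lap (fun y => 2 * G.Gam f g y) x
      - 2 * G.Gam f (G.connLap g) x - 2 * G.Gam (G.connLap f) g x := by
    have : G.lap (fun y => 2 * G.Gam f g y) x = 2 * G.lap (G.Gam f g) x := by
      simp only [lap, Finset.mul_sum]
      exact Finset.sum_congr rfl fun y _ => by ring
    rw [this, Gam2]; ring
  have h2 : 2 * (G.connLap f x ⬝ᵥ star (G.connLap g x))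
      = ∑ y ∈ G.nbr x, (G.p x y : ℂ) * (G.diff f x y ⬝ᵥ star (G.connLap g x)
        + G.connLap f x ⬝ᵥ star (G.diff g x y)) := by
    simp only [mul_add, Finset.sum_add_distrib]
    rw [two_mul]
    congr 1
    · conv_lhs => rw [connLap_eq, sum_dotProduct]
      simp
    · conv_lhs => rw [star_connLap, dotProduct_sum]
      simp
  -- The `-2Γ(f,g)(x)` part of the Laplacian is the source of the `deg x` term.
  have h3 : ∑ y ∈ G.nbr x, (G.p x y : ℂ) * (2 * G.Gam f g x)
      = ∑ y ∈ G.nbr x, (G.p x y : ℂ) * (G.deg x * (G.diff f x y ⬝ᵥ star (G.diff g x y))) := by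
    rw [← Finset.sum_mul, two_Gam, ← deg, Finset.mul_sum]
    exact Finset.sum_congr rfl fun y _ => by ring
  rw [h1, h2, two_Gam, two_Gam, lap]
  simp only [mul_sub, Finset.sum_sub_distrib]
  rw [h3]
  simp only [← Finset.sum_sub_distrib, ← Finset.sum_add_distrib]
  refine Finset.sum_congr rfl fun y _ => ?_
  have k := key y
  have e1 : G.diff f x y ⬝ᵥ star (G.diff (G.connLap g) x y)
      = G.diff f x y ⬝ᵥ star ((G.σ x y : Matrix (Fin d) (Fin d) ℂ) *ᵥ G.connLap g y)
        - G.diff f x y ⬝ᵥ star (G.connLap g x) := by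
    rw [← dotProduct_sub, ← star_sub]; rfl
  have e2 : G.diff (G.connLap f) x y ⬝ᵥ star (G.diff g x y)
      = (G.σ x y : Matrix (Fin d) (Fin d) ℂ) *ᵥ G.connLap f y ⬝ᵥ star (G.diff g x y)
        - G.connLap f x ⬝ᵥ star (G.diff g x y) := by
    rw [← sub_dotProduct]; rfl
  rw [e1, e2]
  linear_combination (G.p x y : ℂ) * k

theorem diff_add (f g : V → Fin d → ℂ) (x y : V) :
    G.diff (f + g) x y = G.diff f x y + G.diff g x y := by
  simp only [diff, Pi.add_apply, Matrix.mulVec_add]; abel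

theorem diff_smul (c : ℂ) (f : V → Fin d → ℂ) (x y : V) :
    G.diff (c • f) x y = c • G.diff f x y := by
  simp only [diff, Pi.smul_apply, Matrix.mulVec_smul, smul_sub]

theorem diff2_add (f g : V → Fin d → ℂ) (x y z : V) :
    G.diff2 (f + g) x y z = G.diff2 f x y z + G.diff2 g x y z := by
  simp only [diff2, diff_add, Matrix.mulVec_add]; abel

theorem diff2_smul (c : ℂ) (f : V → Fin d → ℂ) (x y z : V) :
    G.diff2 (c • f) x y z = c • G.diff2 f x y z := by
  simp only [diff2, diff_smul, Matrix.mulVec_smul, smul_sub]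

theorem connLap_add (f g : V → Fin d → ℂ) (x : V) :
    G.connLap (f + g) x = G.connLap f x + G.connLap g x := by
  simp only [connLap_eq, diff_add, smul_add, Finset.sum_add_distrib]

theorem connLap_smul (c : ℂ) (f : V → Fin d → ℂ) (x : V) :
    G.connLap (c • f) x = c • G.connLap f x := by
  simp only [connLap_eq, diff_smul, Finset.smul_sum]
  exact Finset.sum_congr rfl fun y _ => smul_comm _ _ _

theorem Gam2_add_left (f₁ f₂ g : V → Fin d → ℂ) (x : V) :
    G.Gam2 (f₁ + f₂) g x = G.Gam2 f₁ g x + G.Gam2 f₂ g x := by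
  have h : (4 : ℂ) * G.Gam2 (f₁ + f₂) g x = 4 * (G.Gam2 f₁ g x + G.Gam2 f₂ g x) := by
    rw [mul_add]
    simp only [four_Gam2, diff_add, diff2_add, connLap_add, add_dotProduct, mul_add,
      Finset.sum_add_distrib]
    ring
  exact mul_left_cancel₀ (by norm_num) h

theorem Gam2_smul_left (c : ℂ) (f g : V → Fin d → ℂ) (x : V) :
    G.Gam2 (c • f) g x = c * G.Gam2 f g x := by
  have h : (4 : ℂ) * G.Gam2 (c • f) g x = c * (4 * G.Gam2 f g x) := by
    simp only [four_Gam2, diff_smul, diff2_smul, connLap_smul, smul_dotProduct, smul_eq_mul,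
      mul_add, mul_sub, Finset.mul_sum]
    refine congrArg₂ _ (congrArg₂ _ ?_ ?_) ?_
    · refine Finset.sum_congr rfl fun y _ => Finset.sum_congr rfl fun z _ => ?_
      ring
    · exact Finset.sum_congr rfl fun y _ => by ring
    · ring
  refine mul_left_cancel₀ (b := G.Gam2 (c • f) g x) (a := (4 : ℂ)) (by norm_num) ?_
  rw [h]; ring

theorem star_dotProduct_star_swap (u v : Fin d → ℂ) : star (u ⬝ᵥ star v) = v ⬝ᵥ star u := by
  rw [← Matrix.dotProduct_star]

theorem star_Gam2 (f g : V → Fin d → ℂ) (x : V) : star (G.Gam2 f g x) = G.Gam2 g f x := by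
  have hdeg : ∀ y, star (G.deg y) = G.deg y := fun y => by simp [deg]
  have h : star ((4 : ℂ) * G.Gam2 f g x) = 4 * G.Gam2 g f x := by
    simp only [four_Gam2, star_add, star_sub, star_mul', star_sum, star_dotProduct_star_swap,
      hdeg]
    simp
  rw [star_mul'] at h
  have h4 : star (4 : ℂ) = 4 := by simp
  rw [h4] at h
  exact mul_left_cancel₀ (by norm_num) h

/-- Locality: the expansion `four_Gam2` only evaluates functions at the end points of paths of
length at most two from `x`. -/
theorem Gam2_congr_left {f₁ f₂ : V → Fin d → ℂ} (g : V → Fin d → ℂ) {x : V} (h0 : f₁ x = f₂ x)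
    (h1 : ∀ y ∈ G.nbr x, f₁ y = f₂ y) (h2 : ∀ y ∈ G.nbr x, ∀ z ∈ G.nbr y, f₁ z = f₂ z) :
    G.Gam2 f₁ g x = G.Gam2 f₂ g x := by
  have e1 : ∀ y ∈ G.nbr x, G.diff f₁ x y = G.diff f₂ x y := fun y hy => by
    simp only [diff, h0, h1 y hy]
  have e2 : ∀ y ∈ G.nbr x, ∀ z ∈ G.nbr y, G.diff2 f₁ x y z = G.diff2 f₂ x y z :=
    fun y hy z hz => by
      rw [diff2, diff2, e1 y hy]
      simp only [diff, h1 y hy, h2 y hy z hz]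
  refine mul_left_cancel₀ (a := (4 : ℂ)) (by norm_num) ?_
  have e3 : G.connLap f₁ x = G.connLap f₂ x := by
    rw [connLap_eq, connLap_eq]
    exact Finset.sum_congr rfl fun y hy => by rw [e1 y hy]
  rw [four_Gam2, four_Gam2, e3]
  refine congrArg₂ _ (congrArg₂ _ ?_ ?_) rfl
  · refine Finset.sum_congr rfl fun y hy => congrArg _ ?_
    exact Finset.sum_congr rfl fun z hz => by rw [e2 y hy z hz]
  · exact Finset.sum_congr rfl fun y hy => by rw [e1 y hy]

end Calculus

end ConnectionGraph

namespace ConnectionGraph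

/-! ### Critical extensions and the Schur complement `Q` -/

section Extension

variable {V : Type*} {d : ℕ} (G : ConnectionGraph V d)

theorem mem_sphere_one_iff_mem_nbr {x y : V} : y ∈ G.sphere x 1 ↔ y ∈ G.nbr x := by
  rw [mem_sphere_one, mem_nbr]

theorem mem_nbr_comm {x y : V} : y ∈ G.nbr x ↔ x ∈ G.nbr y := by
  rw [mem_nbr, mem_nbr, G.w_symm]

theorem mem_sphere_two {x z : V} :
    z ∈ G.sphere x 2 ↔ z ≠ x ∧ z ∉ G.nbr x ∧ ∃ y ∈ G.nbr x, z ∈ G.nbr y := by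
  have hadj : ∀ u v, v ∈ G.nbr u ↔ G.graph.Adj u v := fun u v => G.mem_nbr
  simp only [hadj]
  have hm : z ∈ G.sphere x 2 ↔ G.graph.edist x z = 2 := Iff.rfl
  rw [hm]
  constructor
  · intro h
    refine ⟨?_, ?_, ?_⟩
    · rintro rfl
      rw [SimpleGraph.edist_self] at h
      exact absurd h (by decide)
    · intro h1
      rw [SimpleGraph.edist_eq_one_iff_adj.2 h1] at h
      exact absurd h (by decide)
    · have hr : G.graph.Reachable x z := SimpleGraph.reachable_of_edist_ne_top (by
        rw [h]; exact ENat.natCast_ne_top 2)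
      obtain ⟨q, hq⟩ := hr.exists_walk_length_eq_edist
      rw [h] at hq
      have hq' : q.length = 2 := by exact_mod_cast hq
      cases q with
      | nil => simp at hq'
      | @cons _ y _ h1 q =>
        cases q with
        | nil => simp at hq'
        | @cons _ u _ h2 q =>
          have hl : q.length = 0 := by
            simp only [SimpleGraph.Walk.length_cons] at hq'; omega
          obtain rfl := SimpleGraph.Walk.eq_of_length_eq_zero hl
          exact ⟨y, h1, h2⟩
  · rintro ⟨hne, hna, y, h1, h2⟩
    have hle : G.graph.edist x z ≤ 2 :=
      SimpleGraph.edist_le (SimpleGraph.Walk.cons h1 (SimpleGraph.Walk.cons h2 .nil))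
    have hr : G.graph.Reachable x z := ⟨SimpleGraph.Walk.cons h1 (SimpleGraph.Walk.cons h2 .nil)⟩
    obtain ⟨n, hn⟩ := ENat.ne_top_iff_exists.1
      (ne_top_of_le_ne_top (ENat.natCast_ne_top 2) hle)
    rw [← hn] at hle ⊢
    have hn2 : n ≤ 2 := by exact_mod_cast hle
    have h0 : n ≠ 0 := by
      rintro rfl
      exact hne (SimpleGraph.edist_eq_zero_iff.1 hn.symm).symm
    have h1' : n ≠ 1 := by
      rintro rfl
      exact hna (SimpleGraph.edist_eq_one_iff_adj.1 hn.symm)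
    have : n = 2 := by omega
    rw [this]; rfl

/-- The inclusion of the index set of `B_2(x)`. -/
def embBall (x : V) : G.IdxB x ⊕ G.Idx2 x → V × Fin d := Sum.elim (G.embB x) (G.emb2 x)

theorem self_notMem_nbr (x : V) : x ∉ G.nbr x := fun h => G.mem_nbr.1 h (G.w_self x)

theorem embBall_injective (x : V) : Function.Injective (G.embBall x) := by
  have h1 : ∀ y : G.sphere x 1, y.1 ∈ G.nbr x := fun y => G.mem_sphere_one_iff_mem_nbr.1 y.2
  have h2 : ∀ y : G.sphere x 2, y.1 ≠ x ∧ y.1 ∉ G.nbr x := fun y =>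
    ⟨(G.mem_sphere_two.1 y.2).1, (G.mem_sphere_two.1 y.2).2.1⟩
  have h3 : ∀ y : G.sphere x 1, y.1 ≠ x := fun y e =>
    G.self_notMem_nbr x (by have := h1 y; rwa [e] at this)
  rintro ((i | ⟨y, i⟩) | ⟨y, i⟩) ((j | ⟨z, j⟩) | ⟨z, j⟩) h <;>
    simp only [embBall, embB, emb2, Sum.elim_inl, Sum.elim_inr, Prod.mk.injEq] at h
  · rw [h.2]
  · exact absurd h.1.symm (h3 z)
  · exact absurd h.1.symm (h2 z).1
  · exact absurd h.1 (h3 y)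
  · rw [Subtype.ext h.1, h.2]
  · exact absurd (h.1 ▸ h1 y) (h2 z).2
  · exact absurd h.1 (h2 y).1
  · exact absurd (h.1 ▸ h1 z) (h2 y).2
  · rw [Subtype.ext h.1, h.2]

open Classical in
theorem basisFun_apply (q : V × Fin d) (v : V) (i : Fin d) :
    basisFun q v i = if q = (v, i) then 1 else 0 := by
  obtain ⟨u, j⟩ := q
  by_cases h : v = u
  · subst h
    by_cases h' : i = j
    · subst h'; simp [basisFun]
    · simp [basisFun, h', Ne.symm h']
  · simp [basisFun, h, Ne.symm h]

theorem sum_smul_basisFun_apply_of_notMem {J : Type*} [Fintype J] (c : J → ℂ)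
    (e : J → V × Fin d) {v : V} {i : Fin d} (h : ∀ j, e j ≠ (v, i)) :
    (∑ j, c j • basisFun (e j)) v i = 0 := by
  simp [Finset.sum_apply, basisFun_apply, h]

theorem sum_smul_basisFun_apply {J : Type*} [Fintype J] (c : J → ℂ)
    {e : J → V × Fin d} (he : Function.Injective e) (j : J) :
    (∑ j, c j • basisFun (e j)) (e j).1 (e j).2 = c j := by
  classical
  simp [Finset.sum_apply, basisFun_apply, he.eq_iff]

/-- `f ↦ Γ₂^σ(f,g)(x)` as a linear form. -/
noncomputable def Gam2Left (g : V → Fin d → ℂ) (x : V) : (V → Fin d → ℂ) →ₗ[ℂ] ℂ where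
  toFun f := G.Gam2 f g x
  map_add' f₁ f₂ := G.Gam2_add_left f₁ f₂ g x
  map_smul' c f := G.Gam2_smul_left c f g x

theorem Gam2_sum_left {J : Type*} [Fintype J] (c : J → ℂ) (f : J → V → Fin d → ℂ)
    (g : V → Fin d → ℂ) (x : V) :
    G.Gam2 (∑ j, c j • f j) g x = ∑ j, c j * G.Gam2 (f j) g x := by
  have : G.Gam2Left g x (∑ j, c j • f j) = ∑ j, c j * G.Gam2Left g x (f j) := by
    simp
  exact this

/-- `V` may be infinite, so `f` need not be a finite combination of basis functions; its truncation
to `B_2(x)` is, and locality allows the replacement. -/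
theorem Gam2_eq_sum_left (f g : V → Fin d → ℂ) (x : V) :
    G.Gam2 f g x = ∑ j, f (G.embBall x j).1 (G.embBall x j).2
      * G.Gam2 (basisFun (G.embBall x j)) g x := by
  rw [← Gam2_sum_left]
  have key := sum_smul_basisFun_apply
    (fun j => f (G.embBall x j).1 (G.embBall x j).2) (G.embBall_injective x)
  have hx : ∀ i, f x i = (∑ j, f (G.embBall x j).1 (G.embBall x j).2 •
      basisFun (G.embBall x j)) x i := fun i => (key (Sum.inl (Sum.inl i))).symm
  have hy : ∀ y ∈ G.nbr x, ∀ i, f y i = (∑ j, f (G.embBall x j).1 (G.embBall x j).2 •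
      basisFun (G.embBall x j)) y i := fun y hy i =>
    (key (Sum.inl (Sum.inr (⟨y, G.mem_sphere_one_iff_mem_nbr.2 hy⟩, i)))).symm
  refine G.Gam2_congr_left g (funext hx) (fun y h => funext (hy y h)) fun y h z hz => ?_
  by_cases h0 : z = x
  · subst h0; exact funext hx
  by_cases h1 : z ∈ G.nbr x
  · exact funext (hy z h1)
  · exact funext fun i =>
      (key (Sum.inr (⟨z, G.mem_sphere_two.2 ⟨h0, h1, y, h, hz⟩⟩, i))).symm

theorem Gam2_eq_sum_right (f g : V → Fin d → ℂ) (x : V) :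
    G.Gam2 f g x = ∑ j, G.Gam2 f (basisFun (G.embBall x j)) x
      * star (g (G.embBall x j).1 (G.embBall x j).2) := by
  rw [← star_Gam2, Gam2_eq_sum_left, star_sum]
  exact Finset.sum_congr rfl fun j _ => by rw [star_mul', star_Gam2, mul_comm]

/-- If `f` is covariantly constant on `B_1(x)`, only second differences contribute. -/
theorem four_Gam2_of_diff_eq_zero {f : V → Fin d → ℂ} {x : V}
    (hf : ∀ y ∈ G.nbr x, G.diff f x y = 0) (g : V → Fin d → ℂ) :
    4 * G.Gam2 f g x = ∑ y ∈ G.nbr x, (G.p x y : ℂ) * ∑ z ∈ G.nbr y, (G.p y z : ℂ) *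
          (G.diff2 f x y z ⬝ᵥ star (G.diff2 g x y z)) := by
  have h : G.connLap f x = 0 := by
    rw [connLap_eq]
    exact Finset.sum_eq_zero fun y hy => by rw [hf y hy, smul_zero]
  have h' : ∑ y ∈ G.nbr x, (G.p x y : ℂ) * ((G.deg x + G.deg y) *
          (G.diff f x y ⬝ᵥ star (G.diff g x y))) = 0 :=
    Finset.sum_eq_zero fun y hy => by rw [hf y hy]; simp
  rw [four_Gam2, h, h']
  simp

theorem Gam2_self_nonneg_of_diff_eq_zero {f : V → Fin d → ℂ} {x : V}
    (hf : ∀ y ∈ G.nbr x, G.diff f x y = 0) : 0 ≤ 4 * G.Gam2 f f x := by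
  rw [four_Gam2_of_diff_eq_zero G hf]
  refine Finset.sum_nonneg fun y hy => mul_nonneg ?_ (Finset.sum_nonneg fun z hz =>
    mul_nonneg ?_ (dotProduct_self_star_nonneg _))
  · exact_mod_cast (G.p_pos hy).le
  · exact_mod_cast (G.p_pos hz).le

/-- A vanishing sum of squares with strictly positive weights has only zero terms. -/
theorem diff2_eq_zero_of_Gam2_self {f : V → Fin d → ℂ} {x : V}
    (hf : ∀ y ∈ G.nbr x, G.diff f x y = 0) (h : G.Gam2 f f x = 0) :
    ∀ y ∈ G.nbr x, ∀ z ∈ G.nbr y, G.diff2 f x y z = 0 := by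
  intro y hy z hz
  have h4 : 4 * G.Gam2 f f x = 0 := by rw [h, mul_zero]
  have hp : ∀ {u v}, v ∈ G.nbr u → (0 : ℂ) < G.p u v := fun h => by exact_mod_cast G.p_pos h
  have hin : ∀ y, ∀ z ∈ G.nbr y, 0 ≤ (G.p y z : ℂ) *
      (G.diff2 f x y z ⬝ᵥ star (G.diff2 f x y z)) := fun y z hz =>
    mul_nonneg (hp hz).le (dotProduct_self_star_nonneg _)
  rw [four_Gam2_of_diff_eq_zero G hf, Finset.sum_eq_zero_iff_of_nonneg (fun y hy =>
    mul_nonneg (hp hy).le (Finset.sum_nonneg (hin y)))] at h4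
  have h5 := (mul_eq_zero.1 (h4 y hy)).resolve_left (hp hy).ne'
  rw [Finset.sum_eq_zero_iff_of_nonneg (hin y)] at h5
  exact dotProduct_self_star_eq_zero.1 ((mul_eq_zero.1 (h5 z hz)).resolve_left (hp hz).ne')

/-- `f` is critical for `Γ₂^σ(·)(x)` under variations outside `B_1(x)`. -/
def IsOptimalAt (f : V → Fin d → ℂ) (x : V) : Prop :=
  ∀ h : V → Fin d → ℂ, h x = 0 → (∀ y ∈ G.nbr x, h y = 0) → G.Gam2 f h x = 0

theorem isOptimalAt_iff {f : V → Fin d → ℂ} {x : V} :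
    G.IsOptimalAt f x ↔ ∀ k, G.Gam2 f (basisFun (G.emb2 x k)) x = 0 := by
  constructor
  · intro hf k
    have h2 := (G.mem_sphere_two.1 k.1.2)
    refine hf _ (funext fun i => ?_) fun y hy => funext fun i => ?_
    · rw [basisFun_apply, if_neg fun e => h2.1 (congrArg Prod.fst e)]; rfl
    · rw [basisFun_apply, if_neg fun e => h2.2.1 (by
        have e' : k.1.1 = y := congrArg Prod.fst e
        rwa [e'])]; rfl
  · intro hk h h0 h1
    rw [Gam2_eq_sum_right, Fintype.sum_sum_type]
    have : ∀ q, h (G.embB x q).1 (G.embB x q).2 = 0 := by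
      rintro (i | ⟨y, i⟩)
      · exact congrFun h0 i
      · exact congrFun (h1 y.1 (G.mem_sphere_one_iff_mem_nbr.1 y.2)) i
    simp [embBall, this, hk]

/-- The block of `Γ₂^σ(x)` on `S_2(x)`. -/
noncomputable def Gam2Sphere (x : V) : Matrix (G.Idx2 x) (G.Idx2 x) ℂ :=
  (G.Gam2Matrix x).submatrix (G.emb2 x) (G.emb2 x)

-- A left null vector gives a function supported on `S_2(x)` with `Γ₂(f,f)(x) = 0`, hence with no
-- second differences. Along `x → y → z` with `z` in `S_2` the second difference is just `f z`
-- transported to `x`, so `f z = 0`.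
open Classical in
theorem isUnit_det_Gam2Sphere (x : V) : IsUnit (G.Gam2Sphere x).det := by
  rw [isUnit_iff_ne_zero, ne_eq, ← Matrix.exists_vecMul_eq_zero_iff]
  rintro ⟨c, hc0, hc⟩
  have hinj : Function.Injective (G.emb2 x) := fun k l e =>
    Sum.inr_injective (G.embBall_injective x (a₁ := Sum.inr k) (a₂ := Sum.inr l) e)
  obtain ⟨f, hf⟩ : ∃ f : V → Fin d → ℂ, f = ∑ k, c k • basisFun (G.emb2 x k) := ⟨_, rfl⟩
  have hf2 : ∀ k, f (G.emb2 x k).1 (G.emb2 x k).2 = c k := fun k => by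
    rw [hf, sum_smul_basisFun_apply c hinj]
  have h0 : f x = 0 := funext fun i => by
    rw [hf]
    exact sum_smul_basisFun_apply_of_notMem c _ fun k e =>
      (G.mem_sphere_two.1 k.1.2).1 (congrArg Prod.fst e)
  have h1 : ∀ y ∈ G.nbr x, f y = 0 := fun y hy => funext fun i => by
    rw [hf]
    refine sum_smul_basisFun_apply_of_notMem c _ fun k e =>
      (G.mem_sphere_two.1 k.1.2).2.1 ?_
    have e' : k.1.1 = y := congrArg Prod.fst e
    rwa [e']
  have hopt : G.IsOptimalAt f x := by
    rw [isOptimalAt_iff]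
    intro k
    rw [hf, Gam2_sum_left]
    exact congrFun hc k
  have hd : ∀ y ∈ G.nbr x, G.diff f x y = 0 := fun y hy => by simp [diff, h0, h1 y hy]
  have hz := G.diff2_eq_zero_of_Gam2_self hd (hopt f h0 h1)
  refine hc0 (funext fun k => ?_)
  obtain ⟨-, -, y, hy, hyz⟩ := G.mem_sphere_two.1 k.1.2
  have := hz y hy _ hyz
  have h2 : f k.1.1 ⬝ᵥ star (f k.1.1) = 0 := by
    rw [diff2, hd y hy, diff, h1 y hy, sub_zero, sub_zero] at this
    rw [← dotProduct_star_unitary_mulVec (G.σ y k.1.1),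
      ← dotProduct_star_unitary_mulVec (G.σ x y), this, zero_dotProduct]
  have h3 := congrFun (dotProduct_self_star_eq_zero.1 h2) k.2
  rw [← hf2]; exact h3

/-- Criticality is a linear system for the correction on `S_2(x)`, whose matrix is the invertible
block `Gam2Sphere`. -/
theorem exists_isOptimalAt (f₀ : V → Fin d → ℂ) (x : V) :
    ∃ f, f x = f₀ x ∧ (∀ y ∈ G.nbr x, f y = f₀ y) ∧ G.IsOptimalAt f x := by
  classical
  obtain ⟨c, hc⟩ : ∃ c : G.Idx2 x → ℂ, c ᵥ* G.Gam2Sphere x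
      = - fun k => G.Gam2 f₀ (basisFun (G.emb2 x k)) x := by
    refine ⟨(- fun k => G.Gam2 f₀ (basisFun (G.emb2 x k)) x) ᵥ* (G.Gam2Sphere x)⁻¹, ?_⟩
    rw [Matrix.vecMul_vecMul, Matrix.nonsing_inv_mul _ (G.isUnit_det_Gam2Sphere x),
      Matrix.vecMul_one]
  refine ⟨f₀ + ∑ k, c k • basisFun (G.emb2 x k), ?_, ?_, ?_⟩
  · refine funext fun i => ?_
    rw [Pi.add_apply, Pi.add_apply, sum_smul_basisFun_apply_of_notMem c _ fun k e =>
      (G.mem_sphere_two.1 k.1.2).1 (congrArg Prod.fst e), add_zero]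
  · refine fun y hy => funext fun i => ?_
    rw [Pi.add_apply, Pi.add_apply, sum_smul_basisFun_apply_of_notMem c _ fun k e =>
      (G.mem_sphere_two.1 k.1.2).2.1 ?_, add_zero]
    have e' : k.1.1 = y := congrArg Prod.fst e
    rwa [e']
  · rw [isOptimalAt_iff]
    intro k
    rw [Gam2_add_left, Gam2_sum_left]
    have : ∑ j, c j * G.Gam2 (basisFun (G.emb2 x j)) (basisFun (G.emb2 x k)) x
        = - G.Gam2 f₀ (basisFun (G.emb2 x k)) x := congrFun hc k
    rw [this, add_neg_cancel]

/-- Solving the criticality equations for the `S_2` values of `f` produces the Schur complement.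
Only `f` has to be critical: that already annihilates the contribution of `g` from `S_2`. -/
theorem IsOptimalAt.Gam2_eq {f : V → Fin d → ℂ} {x : V} (hf : G.IsOptimalAt f x)
    (g : V → Fin d → ℂ) :
    G.Gam2 f g x = (fun q => f (G.embB x q).1 (G.embB x q).2) ⬝ᵥ
      G.Q x *ᵥ star (fun q => g (G.embB x q).1 (G.embB x q).2) := by
  classical
  set fB : G.IdxB x → ℂ := fun q => f (G.embB x q).1 (G.embB x q).2 with hfB
  set f2 : G.Idx2 x → ℂ := fun q => f (G.emb2 x q).1 (G.emb2 x q).2 with hf2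
  set MB2 := (G.Gam2Matrix x).submatrix (G.embB x) (G.emb2 x) with hMB2
  set M2B := (G.Gam2Matrix x).submatrix (G.emb2 x) (G.embB x) with hM2B
  set MBB := (G.Gam2Matrix x).submatrix (G.embB x) (G.embB x) with hMBB
  have e2 : fB ᵥ* MB2 + f2 ᵥ* G.Gam2Sphere x = 0 := funext fun k => by
    have := (G.isOptimalAt_iff.1 hf) k
    rw [Gam2_eq_sum_left, Fintype.sum_sum_type] at this
    exact this
  have e3 : f2 = -((fB ᵥ* MB2) ᵥ* (G.Gam2Sphere x)⁻¹) := by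
    rw [eq_neg_iff_add_eq_zero]
    have := congrArg (fun r => r ᵥ* (G.Gam2Sphere x)⁻¹) e2
    simp only [Matrix.add_vecMul, Matrix.zero_vecMul, Matrix.vecMul_vecMul,
      Matrix.mul_nonsing_inv _ (G.isUnit_det_Gam2Sphere x), Matrix.vecMul_one] at this ⊢
    rw [add_comm]; exact this
  have e4 : fB ᵥ* G.Q x = fB ᵥ* MBB + f2 ᵥ* M2B := by
    rw [e3, Q, Matrix.vecMul_sub, Matrix.neg_vecMul, ← sub_eq_add_neg, ← Matrix.vecMul_vecMul,
      ← Matrix.vecMul_vecMul]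
    rfl
  rw [Matrix.dotProduct_mulVec, e4, Gam2_eq_sum_right, Fintype.sum_sum_type]
  rw [Finset.sum_eq_zero (s := (Finset.univ : Finset (G.Idx2 x))), add_zero]
  · refine Finset.sum_congr rfl fun k _ => ?_
    rw [Gam2_eq_sum_left, Fintype.sum_sum_type]
    rfl
  · intro k _
    have := (G.isOptimalAt_iff.1 hf) k
    simp only [embBall, Sum.elim_inr, this, zero_mul]

/-- `f` restricts on `B_1(x)` to the row vector `v B_0`. -/
structure IsExtension (x : V) (v : G.IdxB x → ℂ) (f : V → Fin d → ℂ) : Prop where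
  at_center : f x = v ∘ Sum.inl
  at_nbr : ∀ y : G.sphere x 1, f y = (G.σ x y : Matrix (Fin d) (Fin d) ℂ)ᴴ *ᵥ (v ∘ Sum.inl)
    + ((1 / √(G.p x y) : ℝ) : ℂ) • fun j => v (Sum.inr (y, j))

theorem IsExtension.eq_vecMul {x : V} {v : G.IdxB x → ℂ} {f : V → Fin d → ℂ}
    (h : G.IsExtension x v f) :
    (fun q => f (G.embB x q).1 (G.embB x q).2) = v ᵥ* G.canonicalB x := by
  classical
  have hv : v = Sum.elim (v ∘ Sum.inl) (v ∘ Sum.inr) := (Sum.elim_comp_inl_inr v).symm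
  rw [canonicalB, Matrix.vecMul_fromBlocks]
  funext q
  rcases q with i | ⟨y, j⟩
  · simp [embB, h.at_center]
  · simp only [embB, Sum.elim_inr, h.at_nbr, Pi.add_apply, Pi.smul_apply, smul_eq_mul,
      Matrix.vecMul_diagonal, Function.comp_apply]
    rw [mul_comm (v _)]
    congr 1
    simp only [Matrix.mulVec, Matrix.vecMul, dotProduct, Matrix.conjTranspose_apply,
      Matrix.of_apply]
    exact Finset.sum_congr rfl fun i _ => mul_comm _ _

theorem IsExtension.of_eq {x : V} {v : G.IdxB x → ℂ} {f g : V → Fin d → ℂ}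
    (h : G.IsExtension x v f) (h0 : g x = f x) (h1 : ∀ y ∈ G.nbr x, g y = f y) :
    G.IsExtension x v g :=
  ⟨h0.trans h.at_center, fun y =>
    (h1 y (G.mem_sphere_one_iff_mem_nbr.1 y.2)).trans (h.at_nbr y)⟩

theorem exists_isExtension (x : V) (v : G.IdxB x → ℂ) :
    ∃ f, G.IsExtension x v f ∧ G.IsOptimalAt f x := by
  classical
  obtain ⟨f₀, hf₀⟩ : ∃ f₀ : V → Fin d → ℂ, G.IsExtension x v f₀ := by
    -- The default branch is the prescribed value at `x`; beyond `B_1(x)` it is arbitrary, since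
    -- `exists_isOptimalAt` accepts any starting function.
    refine ⟨fun y => if h : y ∈ G.sphere x 1 then
      (G.σ x y : Matrix (Fin d) (Fin d) ℂ)ᴴ *ᵥ (v ∘ Sum.inl)
        + ((1 / √(G.p x y) : ℝ) : ℂ) • fun j => v (Sum.inr (⟨y, h⟩, j))
      else v ∘ Sum.inl, ?_, fun y => ?_⟩
    · rw [dif_neg]
      rw [mem_sphere_one_iff_mem_nbr]
      exact G.self_notMem_nbr x
    · rw [dif_pos y.2]
  obtain ⟨f, h0, h1, hf⟩ := G.exists_isOptimalAt f₀ x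
  exact ⟨f, hf₀.of_eq G h0 h1, hf⟩

/-- The bridge from matrices to functions: every later statement about `a`, `ω` and `M` is proved by
evaluating `Γ₂` through this identity. -/
theorem dotProduct_twoBQB_mulVec {x : V} {v w : G.IdxB x → ℂ} {f g : V → Fin d → ℂ}
    (hv : G.IsExtension x v f) (hf : G.IsOptimalAt f x) (hw : G.IsExtension x w g) :
    v ⬝ᵥ G.twoBQB x (G.canonicalB x) *ᵥ star w = 2 * G.Gam2 f g x := by
  rw [hf.Gam2_eq, hv.eq_vecMul, hw.eq_vecMul, twoBQB, Matrix.smul_mulVec, dotProduct_smul,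
    smul_eq_mul, Matrix.star_vecMul, ← Matrix.dotProduct_mulVec, Matrix.mulVec_mulVec,
    Matrix.mulVec_mulVec]

/-- The first block row of `B₀` is the covariantly constant extension of the centre value, so it
drops out of the differences; only the `S_1` coordinates remain. -/
theorem IsExtension.diff_eq {x : V} {v : G.IdxB x → ℂ} {f : V → Fin d → ℂ}
    (h : G.IsExtension x v f) (y : G.sphere x 1) :
    G.diff f x y = ((1 / √(G.p x y) : ℝ) : ℂ) •
      ((G.σ x y : Matrix (Fin d) (Fin d) ℂ) *ᵥ fun j => v (Sum.inr (y, j))) := by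
  have hu : (G.σ x y : Matrix (Fin d) (Fin d) ℂ) * (G.σ x y : Matrix (Fin d) (Fin d) ℂ)ᴴ = 1 :=
    Matrix.mem_unitaryGroup_iff.1 (G.σ x y).2
  rw [diff, h.at_nbr, h.at_center, Matrix.mulVec_add, Matrix.mulVec_mulVec, hu,
    Matrix.one_mulVec, Matrix.mulVec_smul, add_sub_cancel_left]

end Extension

end ConnectionGraph

namespace ConnectionGraph

/-! ### `Γ₂` on the Cartesian product -/

section ProductCalculus

variable {V V' : Type*} {d : ℕ} (G : ConnectionGraph V d) (G' : ConnectionGraph V' d)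
  (α β : ℝ) (hα : 0 < α) (hβ : 0 < β)

theorem mem_nbr_prod {u v : V × V'} : v ∈ (G.prod G' α β hα hβ).nbr u ↔
    (u.2 = v.2 ∧ v.1 ∈ G.nbr u.1) ∨ (u.1 = v.1 ∧ v.2 ∈ G'.nbr u.2) := by
  rw [mem_nbr, mem_nbr, mem_nbr]
  exact prodWeight_ne_zero G G' α β hα hβ u v

theorem p_prod_left (x y : V) (x' : V') :
    (G.prod G' α β hα hβ).p (x, x') (y, x') = α * G.p x y := by
  have h := (G'.μ_pos x').ne'
  have h2 := (G.μ_pos x).ne'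
  have : (G.prod G' α β hα hβ).p (x, x') (y, x')
    = prodWeight G G' α β (x, x') (y, x') / (G.μ x * G'.μ x') := rfl
  rw [this, prodWeight_left, p]
  field_simp

theorem p_prod_right (x : V) (x' y' : V') :
    (G.prod G' α β hα hβ).p (x, x') (x, y') = β * G'.p x' y' := by
  have h := (G'.μ_pos x').ne'
  have h2 := (G.μ_pos x).ne'
  have : (G.prod G' α β hα hβ).p (x, x') (x, y')
    = prodWeight G G' α β (x, x') (x, y') / (G.μ x * G'.μ x') := rfl
  rw [this, prodWeight_right, p]
  field_simp

theorem σ_prod_left (x y : V) (x' : V') :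
    (G.prod G' α β hα hβ).σ (x, x') (y, x') = G.σ x y := by
  simp [prod]

theorem σ_prod_right (x : V) {x' y' : V'} (h : y' ∈ G'.nbr x') :
    (G.prod G' α β hα hβ).σ (x, x') (x, y') = G'.σ x' y' := by
  have : x' ≠ y' := fun e => G'.self_notMem_nbr x' (by rwa [← e] at h)
  simp [prod, this]

theorem sum_nbr_prod {M : Type*} [AddCommMonoid M] (F : V × V' → M) (x : V) (x' : V') :
    ∑ u ∈ (G.prod G' α β hα hβ).nbr (x, x'), F u
      = ∑ y ∈ G.nbr x, F (y, x') + ∑ y' ∈ G'.nbr x', F (x, y') := by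
  classical
  have h : (G.prod G' α β hα hβ).nbr (x, x')
      = (G.nbr x).image (fun y => (y, x')) ∪ (G'.nbr x').image (fun y' => (x, y')) := by
    ext ⟨y, y'⟩
    rw [mem_nbr_prod]
    simp only [Finset.mem_union, Finset.mem_image, Prod.mk.injEq]
    constructor
    · rintro (⟨h1, h2⟩ | ⟨h1, h2⟩)
      · exact Or.inl ⟨y, h2, rfl, h1⟩
      · exact Or.inr ⟨y', h2, h1, rfl⟩
    · rintro (⟨z, h1, h2, h3⟩ | ⟨z, h1, h2, h3⟩)
      · exact Or.inl ⟨h3, h2 ▸ h1⟩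
      · exact Or.inr ⟨h2, h3 ▸ h1⟩
  rw [h, Finset.sum_union, Finset.sum_image, Finset.sum_image]
  · intro a _ b _ e; exact congrArg Prod.snd e
  · intro a _ b _ e; exact congrArg Prod.fst e
  · rw [Finset.disjoint_left]
    rintro ⟨y, y'⟩ h1 h2
    simp only [Finset.mem_image, Prod.mk.injEq] at h1 h2
    obtain ⟨a, ha, h3, -⟩ := h1
    obtain ⟨b, -, h4, -⟩ := h2
    exact G.self_notMem_nbr x (by rwa [h3, ← h4] at ha)

theorem deg_prod (x : V) (x' : V') :
    (G.prod G' α β hα hβ).deg (x, x') = α * G.deg x + β * G'.deg x' := by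
  rw [deg, sum_nbr_prod, deg, deg, Finset.mul_sum, Finset.mul_sum]
  simp only [p_prod_left, p_prod_right, Complex.ofReal_mul]

theorem diff_prod_left (F : V × V' → Fin d → ℂ) (x y : V) (x' : V') :
    (G.prod G' α β hα hβ).diff F (x, x') (y, x') = G.diff (fun v => F (v, x')) x y := by
  rw [diff, σ_prod_left]; rfl

theorem diff_prod_right (F : V × V' → Fin d → ℂ) (x : V) {x' y' : V'} (h : y' ∈ G'.nbr x') :
    (G.prod G' α β hα hβ).diff F (x, x') (x, y') = G'.diff (fun v => F (x, v)) x' y' := by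
  rw [diff, σ_prod_right _ _ _ _ _ _ _ h]; rfl

/-- The mixed second difference of `F` over the square spanned by `x → y` and `x' → y'`. -/
def mixedDiff (F : V × V' → Fin d → ℂ) (x y : V) (x' y' : V') : Fin d → ℂ :=
  (G.σ x y : Matrix (Fin d) (Fin d) ℂ) *ᵥ G'.diff (fun v => F (y, v)) x' y'
    - G'.diff (fun v => F (x, v)) x' y'

/-- Each square with corners `(x,x')` and `(y,y')` is crossed by two paths, whose second differences
are `N - D` and `N + D`, with `N` the mixed difference and `D` the difference of the two edge
differences. By the parallelogram law they contribute `2N² + 2D²`; the `D²` part cancels against the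
mixed degree terms and the cross terms of the squared Laplacian. -/
theorem Gam2_prod
    (hcomm : ∀ x y, y ∈ G.nbr x → ∀ x' y', y' ∈ G'.nbr x' →
      G.σ x y * G'.σ x' y' = G'.σ x' y' * G.σ x y)
    (F H : V × V' → Fin d → ℂ) (x : V) (x' : V') :
    2 * (G.prod G' α β hα hβ).Gam2 F H (x, x')
      = α ^ 2 * (2 * G.Gam2 (fun v => F (v, x')) (fun v => H (v, x')) x)
        + β ^ 2 * (2 * G'.Gam2 (fun v => F (x, v)) (fun v => H (x, v)) x')
        + α * β * ∑ y ∈ G.nbr x, (G.p x y : ℂ) * ∑ y' ∈ G'.nbr x', (G'.p x' y' : ℂ) *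
          (G.mixedDiff G' F x y x' y' ⬝ᵥ star (G.mixedDiff G' H x y x' y')) := by
  -- The only use of commutation: the mixed difference does not depend on which factor is
  -- differenced first.
  have hmix : ∀ K : V × V' → Fin d → ℂ, ∀ y ∈ G.nbr x, ∀ y' ∈ G'.nbr x',
      (G'.σ x' y' : Matrix (Fin d) (Fin d) ℂ) *ᵥ G.diff (fun v => K (v, y')) x y
        - G.diff (fun v => K (v, x')) x y = G.mixedDiff G' K x y x' y' := by
    intro K y hy y' hy'
    have hc := congrArg Subtype.val (hcomm x y hy x' y' hy')
    have hc' : (G.σ x y : Matrix (Fin d) (Fin d) ℂ) * (G'.σ x' y' : Matrix (Fin d) (Fin d) ℂ)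
      = (G'.σ x' y' : Matrix (Fin d) (Fin d) ℂ) * (G.σ x y : Matrix (Fin d) (Fin d) ℂ) := hc
    simp only [mixedDiff, diff, Matrix.mulVec_sub, Matrix.mulVec_mulVec, hc']
    abel
  set F₁ : V → Fin d → ℂ := fun v => F (v, x') with hF₁
  set F₂ : V' → Fin d → ℂ := fun v => F (x, v) with hF₂
  set H₁ : V → Fin d → ℂ := fun v => H (v, x') with hH₁
  set H₂ : V' → Fin d → ℂ := fun v => H (x, v) with hH₂
  have hlap : ∀ K : V × V' → Fin d → ℂ, (G.prod G' α β hα hβ).connLap K (x, x')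
      = (α : ℂ) • G.connLap (fun v => K (v, x')) x
        + (β : ℂ) • G'.connLap (fun v => K (x, v)) x' := by
    intro K
    rw [connLap_eq, sum_nbr_prod, connLap_eq, connLap_eq, Finset.smul_sum, Finset.smul_sum]
    refine congrArg₂ _ (Finset.sum_congr rfl fun y _ => ?_) (Finset.sum_congr rfl fun y' h => ?_)
    · rw [p_prod_left, diff_prod_left, Complex.ofReal_mul, mul_smul]
    · rw [p_prod_right, diff_prod_right _ _ _ _ _ _ _ _ h, Complex.ofReal_mul, mul_smul]
  have hLR : ∀ K : V × V' → Fin d → ℂ, ∀ y ∈ G.nbr x, ∀ y' ∈ G'.nbr x',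
      (G.prod G' α β hα hβ).diff2 K (x, x') (y, x') (y, y') = G.mixedDiff G' K x y x' y'
        - (G.diff (fun v => K (v, x')) x y - G'.diff (fun v => K (x, v)) x' y') := by
    intro K y _ y' hy'
    rw [diff2, diff_prod_left, diff_prod_right _ _ _ _ _ _ _ _ hy', σ_prod_left, mixedDiff]
    abel
  have hRL : ∀ K : V × V' → Fin d → ℂ, ∀ y ∈ G.nbr x, ∀ y' ∈ G'.nbr x',
      (G.prod G' α β hα hβ).diff2 K (x, x') (x, y') (y, y') = G.mixedDiff G' K x y x' y'
        + (G.diff (fun v => K (v, x')) x y - G'.diff (fun v => K (x, v)) x' y') := by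
    intro K y hy y' hy'
    rw [← hmix K y hy y' hy', diff2, diff_prod_left, diff_prod_right _ _ _ _ _ _ _ _ hy',
      σ_prod_right _ _ _ _ _ _ _ hy']
    abel
  have hLL : ∀ K : V × V' → Fin d → ℂ, ∀ y z,
      (G.prod G' α β hα hβ).diff2 K (x, x') (y, x') (z, x')
        = G.diff2 (fun v => K (v, x')) x y z := by
    intro K y z
    rw [diff2, diff_prod_left, diff_prod_left, σ_prod_left, diff2]
  have hRR : ∀ K : V × V' → Fin d → ℂ, ∀ y' ∈ G'.nbr x', ∀ z' ∈ G'.nbr y',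
      (G.prod G' α β hα hβ).diff2 K (x, x') (x, y') (x, z')
        = G'.diff2 (fun v => K (x, v)) x' y' z' := by
    intro K y' hy' z' hz'
    rw [diff2, diff_prod_right _ _ _ _ _ _ _ _ hy', diff_prod_right _ _ _ _ _ _ _ _ hz',
      σ_prod_right _ _ _ _ _ _ _ hy', diff2]
  -- The `D²` part, in exactly the terms needed for the cancellation.
  have hs : ∑ y ∈ G.nbr x, (G.p x y : ℂ) * ∑ y' ∈ G'.nbr x', (G'.p x' y' : ℂ) *
      ((G.diff F₁ x y - G'.diff F₂ x' y') ⬝ᵥ star (G.diff H₁ x y - G'.diff H₂ x' y'))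
      = G'.deg x' * ∑ y ∈ G.nbr x, (G.p x y : ℂ) * (G.diff F₁ x y ⬝ᵥ star (G.diff H₁ x y))
      + G.deg x * ∑ y' ∈ G'.nbr x', (G'.p x' y' : ℂ) *
          (G'.diff F₂ x' y' ⬝ᵥ star (G'.diff H₂ x' y'))
      - G.connLap F₁ x ⬝ᵥ star (G'.connLap H₂ x')
      - G'.connLap F₂ x' ⬝ᵥ star (G.connLap H₁ x) := by
    rw [star_connLap, star_connLap, connLap_eq, connLap_eq]
    simp only [sum_dotProduct, dotProduct_sum, deg, Finset.mul_sum, Finset.sum_mul,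
      smul_dotProduct, dotProduct_smul, smul_eq_mul]
    rw [Finset.sum_comm (s := G'.nbr x') (t := G.nbr x),
      Finset.sum_comm (s := G'.nbr x') (t := G.nbr x)]
    simp only [← Finset.sum_add_distrib, ← Finset.sum_sub_distrib]
    refine Finset.sum_congr rfl fun y _ => Finset.sum_congr rfl fun y' _ => ?_
    simp only [star_sub, dotProduct_sub, sub_dotProduct]
    ring
  have hfirst : ∑ u ∈ (G.prod G' α β hα hβ).nbr (x, x'),
      ((G.prod G' α β hα hβ).p (x, x') u : ℂ) * ∑ v ∈ (G.prod G' α β hα hβ).nbr u,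
        ((G.prod G' α β hα hβ).p u v : ℂ) * ((G.prod G' α β hα hβ).diff2 F (x, x') u v ⬝ᵥ
          star ((G.prod G' α β hα hβ).diff2 H (x, x') u v))
      = α ^ 2 * ∑ y ∈ G.nbr x, (G.p x y : ℂ) * ∑ z ∈ G.nbr y, (G.p y z : ℂ) *
          (G.diff2 F₁ x y z ⬝ᵥ star (G.diff2 H₁ x y z))
        + β ^ 2 * ∑ y ∈ G'.nbr x', (G'.p x' y : ℂ) * ∑ z ∈ G'.nbr y, (G'.p y z : ℂ) *
          (G'.diff2 F₂ x' y z ⬝ᵥ star (G'.diff2 H₂ x' y z))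
        + 2 * α * β * (∑ y ∈ G.nbr x, (G.p x y : ℂ) * ∑ y' ∈ G'.nbr x', (G'.p x' y' : ℂ) *
            (G.mixedDiff G' F x y x' y' ⬝ᵥ star (G.mixedDiff G' H x y x' y'))
          + ∑ y ∈ G.nbr x, (G.p x y : ℂ) * ∑ y' ∈ G'.nbr x', (G'.p x' y' : ℂ) *
      ((G.diff F₁ x y - G'.diff F₂ x' y') ⬝ᵥ star (G.diff H₁ x y - G'.diff H₂ x' y'))) := by
    rw [sum_nbr_prod]
    simp only [sum_nbr_prod, p_prod_left, p_prod_right, Complex.ofReal_mul, mul_add,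
      Finset.sum_add_distrib, hLL]
    have e1 : ∑ y' ∈ G'.nbr x', (β : ℂ) * (G'.p x' y' : ℂ) * ∑ z' ∈ G'.nbr y',
        (β : ℂ) * (G'.p y' z' : ℂ) * ((G.prod G' α β hα hβ).diff2 F (x, x') (x, y') (x, z') ⬝ᵥ
          star ((G.prod G' α β hα hβ).diff2 H (x, x') (x, y') (x, z')))
        = β ^ 2 * ∑ y ∈ G'.nbr x', (G'.p x' y : ℂ) * ∑ z ∈ G'.nbr y, (G'.p y z : ℂ) *
          (G'.diff2 F₂ x' y z ⬝ᵥ star (G'.diff2 H₂ x' y z)) := by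
      simp only [Finset.mul_sum]
      refine Finset.sum_congr rfl fun y hy => Finset.sum_congr rfl fun z hz => ?_
      rw [hRR F y hy z hz, hRR H y hy z hz]
      ring
    have e2 : ∑ y ∈ G.nbr x, (α : ℂ) * (G.p x y : ℂ) * ∑ y' ∈ G'.nbr x',
        (β : ℂ) * (G'.p x' y' : ℂ) * ((G.prod G' α β hα hβ).diff2 F (x, x') (y, x') (y, y') ⬝ᵥ
          star ((G.prod G' α β hα hβ).diff2 H (x, x') (y, x') (y, y')))
        + ∑ y' ∈ G'.nbr x', (β : ℂ) * (G'.p x' y' : ℂ) * ∑ y ∈ G.nbr x,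
        (α : ℂ) * (G.p x y : ℂ) * ((G.prod G' α β hα hβ).diff2 F (x, x') (x, y') (y, y') ⬝ᵥ
          star ((G.prod G' α β hα hβ).diff2 H (x, x') (x, y') (y, y')))
        = 2 * α * β * ∑ y ∈ G.nbr x, (G.p x y : ℂ) * ∑ y' ∈ G'.nbr x', (G'.p x' y' : ℂ) *
            (G.mixedDiff G' F x y x' y' ⬝ᵥ star (G.mixedDiff G' H x y x' y'))
          + 2 * α * β * ∑ y ∈ G.nbr x, (G.p x y : ℂ) * ∑ y' ∈ G'.nbr x', (G'.p x' y' : ℂ) *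
      ((G.diff F₁ x y - G'.diff F₂ x' y') ⬝ᵥ star (G.diff H₁ x y - G'.diff H₂ x' y')) := by
      simp only [Finset.mul_sum]
      rw [Finset.sum_comm (s := G'.nbr x') (t := G.nbr x)]
      simp only [← Finset.sum_add_distrib]
      refine Finset.sum_congr rfl fun y hy => Finset.sum_congr rfl fun y' hy' => ?_
      rw [hLR F y hy y' hy', hLR H y hy y' hy', hRL F y hy y' hy', hRL H y hy y' hy']
      simp only [star_add, star_sub, dotProduct_sub, sub_dotProduct, dotProduct_add,
        add_dotProduct]
      ring
    have e3 : ∑ y ∈ G.nbr x, (α : ℂ) * (G.p x y : ℂ) * ∑ z ∈ G.nbr y,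
        (α : ℂ) * (G.p y z : ℂ) * (G.diff2 F₁ x y z ⬝ᵥ star (G.diff2 H₁ x y z))
        = α ^ 2 * ∑ y ∈ G.nbr x, (G.p x y : ℂ) * ∑ z ∈ G.nbr y, (G.p y z : ℂ) *
          (G.diff2 F₁ x y z ⬝ᵥ star (G.diff2 H₁ x y z)) := by
      simp only [Finset.mul_sum]
      refine Finset.sum_congr rfl fun y hy => Finset.sum_congr rfl fun z hz => ?_
      ring
    linear_combination e1 + e2 + e3
  have hsecond : ∑ u ∈ (G.prod G' α β hα hβ).nbr (x, x'),
      ((G.prod G' α β hα hβ).p (x, x') u : ℂ) *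
        (((G.prod G' α β hα hβ).deg (x, x') + (G.prod G' α β hα hβ).deg u) *
          ((G.prod G' α β hα hβ).diff F (x, x') u ⬝ᵥ
            star ((G.prod G' α β hα hβ).diff H (x, x') u)))
      = α ^ 2 * ∑ y ∈ G.nbr x, (G.p x y : ℂ) * ((G.deg x + G.deg y) *
          (G.diff F₁ x y ⬝ᵥ star (G.diff H₁ x y)))
        + β ^ 2 * ∑ y ∈ G'.nbr x', (G'.p x' y : ℂ) * ((G'.deg x' + G'.deg y) *
          (G'.diff F₂ x' y ⬝ᵥ star (G'.diff H₂ x' y)))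
        + 2 * α * β * (G'.deg x' * ∑ y ∈ G.nbr x, (G.p x y : ℂ) *
            (G.diff F₁ x y ⬝ᵥ star (G.diff H₁ x y))
          + G.deg x * ∑ y' ∈ G'.nbr x', (G'.p x' y' : ℂ) *
            (G'.diff F₂ x' y' ⬝ᵥ star (G'.diff H₂ x' y'))) := by
    rw [sum_nbr_prod]
    have e1 : ∑ y' ∈ G'.nbr x', ((G.prod G' α β hα hβ).p (x, x') (x, y') : ℂ) *
        (((G.prod G' α β hα hβ).deg (x, x') + (G.prod G' α β hα hβ).deg (x, y')) *
          ((G.prod G' α β hα hβ).diff F (x, x') (x, y') ⬝ᵥ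
            star ((G.prod G' α β hα hβ).diff H (x, x') (x, y'))))
        = β ^ 2 * ∑ y ∈ G'.nbr x', (G'.p x' y : ℂ) * ((G'.deg x' + G'.deg y) *
          (G'.diff F₂ x' y ⬝ᵥ star (G'.diff H₂ x' y)))
        + 2 * α * β * (G.deg x * ∑ y' ∈ G'.nbr x', (G'.p x' y' : ℂ) *
            (G'.diff F₂ x' y' ⬝ᵥ star (G'.diff H₂ x' y'))) := by
      simp only [Finset.mul_sum, ← Finset.sum_add_distrib]
      refine Finset.sum_congr rfl fun y hy => ?_
      rw [diff_prod_right _ _ _ _ _ _ _ _ hy, diff_prod_right _ _ _ _ _ _ _ _ hy, deg_prod,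
        deg_prod, p_prod_right, Complex.ofReal_mul]
      ring
    have e2 : ∑ y ∈ G.nbr x, ((G.prod G' α β hα hβ).p (x, x') (y, x') : ℂ) *
        (((G.prod G' α β hα hβ).deg (x, x') + (G.prod G' α β hα hβ).deg (y, x')) *
          ((G.prod G' α β hα hβ).diff F (x, x') (y, x') ⬝ᵥ
            star ((G.prod G' α β hα hβ).diff H (x, x') (y, x'))))
        = α ^ 2 * ∑ y ∈ G.nbr x, (G.p x y : ℂ) * ((G.deg x + G.deg y) *
          (G.diff F₁ x y ⬝ᵥ star (G.diff H₁ x y)))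
        + 2 * α * β * (G'.deg x' * ∑ y ∈ G.nbr x, (G.p x y : ℂ) *
            (G.diff F₁ x y ⬝ᵥ star (G.diff H₁ x y))) := by
      simp only [Finset.mul_sum, ← Finset.sum_add_distrib]
      refine Finset.sum_congr rfl fun y hy => ?_
      rw [diff_prod_left, diff_prod_left, deg_prod, deg_prod, p_prod_left, Complex.ofReal_mul]
      ring
    linear_combination e1 + e2
  have hfour := (G.prod G' α β hα hβ).four_Gam2 F H (x, x')
  rw [hfirst, hsecond, hlap, hlap, hs] at hfour
  simp only [star_add, star_smul, dotProduct_add, add_dotProduct, smul_dotProduct,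
    dotProduct_smul, smul_eq_mul, RCLike.star_def, Complex.conj_ofReal] at hfour
  have h1 := G.four_Gam2 F₁ H₁ x
  have h2 := G'.four_Gam2 F₂ H₂ x'
  linear_combination (1 / 2 : ℂ) * hfour - (α : ℂ) ^ 2 / 2 * h1 - (β : ℂ) ^ 2 / 2 * h2

/-- The values on `S_1(x) × S_1(x')` are free, as these vertices lie at distance two, and they can
be chosen to kill all mixed differences. Then `Gam2_prod` leaves only the two slices, and
criticality is inherited from them. -/
theorem exists_isOptimalAt_prod
    (hcomm : ∀ x y, y ∈ G.nbr x → ∀ x' y', y' ∈ G'.nbr x' →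
      G.σ x y * G'.σ x' y' = G'.σ x' y' * G.σ x y)
    {x : V} {x' : V'} {f : V → Fin d → ℂ} {f' : V' → Fin d → ℂ} (h0 : f x = f' x')
    (hf : G.IsOptimalAt f x) (hf' : G'.IsOptimalAt f' x') :
    ∃ F : V × V' → Fin d → ℂ, (∀ y, F (y, x') = f y) ∧ (∀ y', F (x, y') = f' y') ∧
      (G.prod G' α β hα hβ).IsOptimalAt F (x, x') ∧
      ∀ H, 2 * (G.prod G' α β hα hβ).Gam2 F H (x, x')
        = α ^ 2 * (2 * G.Gam2 f (fun v => H (v, x')) x)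
          + β ^ 2 * (2 * G'.Gam2 f' (fun v => H (x, v)) x') := by
  classical
  -- The last branch solves the equation `mixedDiff = 0` for `F (y, y')`; off both axes it matters
  -- only when `y ∼ x` and `y' ∼ x'`.
  obtain ⟨F, hF⟩ : ∃ F : V × V' → Fin d → ℂ, F = fun u =>
      if u.2 = x' then f u.1 else if u.1 = x then f' u.2 else
        (G'.σ x' u.2 : Matrix (Fin d) (Fin d) ℂ)ᴴ *ᵥ
          (f u.1 + (G.σ x u.1 : Matrix (Fin d) (Fin d) ℂ)ᴴ *ᵥ G'.diff f' x' u.2) := ⟨_, rfl⟩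
  have h1 : ∀ y, F (y, x') = f y := fun y => by simp [hF]
  have h2 : ∀ y', F (x, y') = f' y' := fun y' => by
    by_cases h : y' = x'
    · subst h; simp [hF, h0]
    · simp [hF, h]
  have hu : ∀ U : Matrix.unitaryGroup (Fin d) ℂ, ∀ v : Fin d → ℂ,
      (U : Matrix (Fin d) (Fin d) ℂ) *ᵥ ((U : Matrix (Fin d) (Fin d) ℂ)ᴴ *ᵥ v) = v := by
    intro U v
    have : (U : Matrix (Fin d) (Fin d) ℂ) * (U : Matrix (Fin d) (Fin d) ℂ)ᴴ = 1 :=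
      Matrix.mem_unitaryGroup_iff.1 U.2
    rw [Matrix.mulVec_mulVec, this, Matrix.one_mulVec]
  have hmixed : ∀ y ∈ G.nbr x, ∀ y' ∈ G'.nbr x', G.mixedDiff G' F x y x' y' = 0 := by
    intro y hy y' hy'
    have hy0 : y ≠ x := fun e => G.self_notMem_nbr x (e ▸ hy)
    have hy0' : y' ≠ x' := fun e => G'.self_notMem_nbr x' (e ▸ hy')
    have e1 : G'.diff (fun v => F (x, v)) x' y' = G'.diff f' x' y' := by
      congr 1; exact funext h2
    have e2 : G'.diff (fun v => F (y, v)) x' y'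
        = (G.σ x y : Matrix (Fin d) (Fin d) ℂ)ᴴ *ᵥ G'.diff f' x' y' := by
      rw [diff, h1]
      simp only [hF, hy0, hy0', if_false, hu]
      abel
    rw [mixedDiff, e1, e2, hu, sub_self]
  have hG : ∀ H, 2 * (G.prod G' α β hα hβ).Gam2 F H (x, x')
        = α ^ 2 * (2 * G.Gam2 f (fun v => H (v, x')) x)
          + β ^ 2 * (2 * G'.Gam2 f' (fun v => H (x, v)) x') := by
    intro H
    have e3 : (fun v => F (v, x')) = f := funext h1
    have e4 : (fun v => F (x, v)) = f' := funext h2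
    rw [Gam2_prod G G' α β hα hβ hcomm, e3, e4, Finset.sum_eq_zero, mul_zero, add_zero]
    intro y hy
    rw [Finset.sum_eq_zero, mul_zero]
    intro y' hy'
    rw [hmixed y hy y' hy', zero_dotProduct, mul_zero]
  refine ⟨F, h1, h2, fun H hH0 hH1 => ?_, hG⟩
  have := hG H
  rw [hf _ hH0 fun y hy => hH1 (y, x') ((mem_nbr_prod ..).2 (Or.inl ⟨rfl, hy⟩)),
    hf' _ hH0 fun y hy => hH1 (x, y) ((mem_nbr_prod ..).2 (Or.inr ⟨rfl, hy⟩))] at this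
  simpa using this

end ProductCalculus

end ConnectionGraph

/-! ### Pseudoinverses and Schur complements -/

section PseudoinverseAlgebra

variable {n m m' : Type*} [Fintype n]

theorem pinv_isHermitian {A : Matrix n n ℂ} (hA : A.IsHermitian) :
    (pinv A).IsHermitian := by
  classical
  obtain ⟨X, hX, hXh⟩ := exists_isPseudoinverse_of_isHermitian hA
  rwa [(pinv_spec A).unique hX]

theorem pinv_smul {k : Type*} [Fintype k] {c : ℂ} (hc : c ≠ 0) (A : Matrix n k ℂ) :
    pinv (c • A) = c⁻¹ • pinv A := by
  have h := pinv_spec A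
  refine (pinv_spec _).unique ⟨?_, ?_, ?_, ?_⟩ <;>
    simp only [Matrix.smul_mul, Matrix.mul_smul, smul_smul, inv_mul_cancel₀ hc,
      mul_inv_cancel₀ hc, one_smul, h.mul_mul_self, h.mul_mul_inv, h.left_herm, h.right_herm]

/-- The rows of `1 - A * pinv A` lie in the left kernel of `A`, hence in that of `B`. -/
theorem mul_pinv_mul_of_vecMul_eq_zero {A : Matrix n n ℂ} {B : Matrix n m ℂ}
    (h : ∀ v : n → ℂ, v ᵥ* A = 0 → v ᵥ* B = 0) : A * (pinv A * B) = B := by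
  classical
  have h1 : (1 - A * pinv A) * A = 0 := by
    rw [Matrix.sub_mul, Matrix.one_mul, (pinv_spec A).mul_mul_self, sub_self]
  have h2 : (1 - A * pinv A) * B = 0 := by
    ext i j
    have := h ((1 - A * pinv A) i) (funext fun k => congrFun (congrFun h1 i) k)
    exact congrFun this j
  rw [Matrix.sub_mul, Matrix.one_mul, sub_eq_zero, Matrix.mul_assoc] at h2
  exact h2.symm

theorem Matrix.mul_mul_mul_of_eq {k l : Type*} [Fintype k] {A : Matrix m n ℂ} {B : Matrix n k ℂ}
    {C : Matrix k n ℂ} {D : Matrix m n ℂ} (h : A * (B * C) = D) (Z : Matrix n l ℂ) :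
    A * (B * (C * Z)) = D * Z := by
  rw [← h]; simp only [Matrix.mul_assoc]

/-- The Schur complement of a sum of two positive semidefinite forms dominates the sum of the
Schur complements. -/
theorem posSemidef_schur_defect [Fintype m] [Fintype m'] {A A' : Matrix n n ℂ}
    {B : Matrix n m ℂ} {B' : Matrix n m' ℂ} (hA : A.PosSemidef) (hA' : A'.PosSemidef)
    (hB : A * (pinv A * B) = B) (hB' : A' * (pinv A' * B') = B') :
    (Matrix.fromBlocks (Bᴴ * (pinv A - pinv (A + A')) * B) (-(Bᴴ * pinv (A + A') * B'))
      (-(B'ᴴ * pinv (A + A') * B)) (B'ᴴ * (pinv A' - pinv (A + A')) * B')).PosSemidef := by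
  set P := pinv (A + A') with hP
  have hPh : Pᴴ = P := pinv_isHermitian (hA.add hA').isHermitian
  have hDh : (pinv A)ᴴ = pinv A := pinv_isHermitian hA.isHermitian
  have hDh' : (pinv A')ᴴ = pinv A' := pinv_isHermitian hA'.isHermitian
  have hBA : Bᴴ * (pinv A * A) = Bᴴ := by
    conv_rhs => rw [← hB]
    rw [Matrix.conjTranspose_mul, Matrix.conjTranspose_mul, hDh, hA.isHermitian.eq,
      Matrix.mul_assoc]
  have hBA' : B'ᴴ * (pinv A' * A') = B'ᴴ := by
    conv_rhs => rw [← hB']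
    rw [Matrix.conjTranspose_mul, Matrix.conjTranspose_mul, hDh', hA'.isHermitian.eq,
      Matrix.mul_assoc]
  have hPP : P * (A' * P) = P - P * (A * P) := by
    rw [eq_sub_iff_add_eq, add_comm, ← Matrix.mul_add, ← Matrix.add_mul, ← Matrix.mul_assoc,
      hP, (pinv_spec (A + A')).mul_mul_inv]
  -- With `s = Bu + B'u'`, the common minimiser is `-Ps`, while the separate ones are `-A†Bu` and
  -- `-A'†B'u'`. Each form exceeds its own minimum by its value on the deviation `A†Bu - Ps`,
  -- respectively `A'†B'u' - Ps`; the defect is the sum of these two excesses.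
  have h := ((hA.conjTranspose_mul_mul_same
      (Matrix.fromCols (pinv A * B - P * B) (-(P * B')))).add
    (hA'.conjTranspose_mul_mul_same (Matrix.fromCols (-(P * B)) (pinv A' * B' - P * B'))))
  convert h using 1
  rw [Matrix.conjTranspose_fromCols_eq_fromRows_conjTranspose,
    Matrix.conjTranspose_fromCols_eq_fromRows_conjTranspose]
  simp only [Matrix.fromRows_mul, Matrix.mul_fromCols, Matrix.fromCols_fromRows_eq_fromBlocks,
    Matrix.fromBlocks_add]
  simp only [Matrix.conjTranspose_sub, Matrix.conjTranspose_neg, Matrix.conjTranspose_mul, hPh,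
    hDh, hDh', Matrix.sub_mul, Matrix.mul_sub, Matrix.neg_mul, Matrix.mul_neg, Matrix.mul_assoc,
    hB, hB', Matrix.mul_mul_mul_of_eq hBA, Matrix.mul_mul_mul_of_eq hBA',
    Matrix.mul_mul_mul_of_eq hPP]
  congr 1 <;> abel

theorem Matrix.ext_of_dotProduct_mulVec_star {k l : Type*} [Fintype k] [Fintype l]
    {A B : Matrix k l ℂ}
    (h : ∀ v w, v ⬝ᵥ A *ᵥ star w = v ⬝ᵥ B *ᵥ star w) : A = B := by
  classical
  ext i j
  have := h (Pi.single i 1) (Pi.single j 1)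
  simpa [← Pi.single_star] using this

theorem Matrix.dotProduct_mulVec_toBlocks {k₁ k₂ l₁ l₂ : Type*} [Fintype k₁] [Fintype k₂]
    [Fintype l₁] [Fintype l₂] (T : Matrix (k₁ ⊕ k₂) (l₁ ⊕ l₂) ℂ) (a : k₁ → ℂ) (b : k₂ → ℂ)
    (c : l₁ → ℂ) (e : l₂ → ℂ) :
    Sum.elim a b ⬝ᵥ T *ᵥ star (Sum.elim c e)
      = a ⬝ᵥ T.toBlocks₁₁ *ᵥ star c + a ⬝ᵥ T.toBlocks₁₂ *ᵥ star e
        + b ⬝ᵥ T.toBlocks₂₁ *ᵥ star c + b ⬝ᵥ T.toBlocks₂₂ *ᵥ star e := by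
  have hs : star (Sum.elim c e) = Sum.elim (star c) (star e) := by
    ext (i | i) <;> rfl
  conv_lhs => rw [← Matrix.fromBlocks_toBlocks T, Matrix.fromBlocks_mulVec, hs]
  rw [dotProduct_block]
  simp only [Sum.elim_comp_inl, Sum.elim_comp_inr, dotProduct_add]
  ring

end PseudoinverseAlgebra

namespace ConnectionGraph

/-! ### The blocks `a` and `ω` at one vertex -/

section Blocks

variable {V : Type*} {d : ℕ} (G : ConnectionGraph V d)

/-- `2 B₀ Q(x) B₀ᴴ`. -/
noncomputable def T₀ (x : V) : Matrix (G.IdxB x) (G.IdxB x) ℂ := G.twoBQB x (G.canonicalB x)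

theorem a₀_eq (x : V) : G.a₀ x = (G.T₀ x).toBlocks₁₁ := rfl

theorem omega₀_eq (x : V) : G.omega₀ x = (G.T₀ x).toBlocks₁₂ᵀ := rfl

theorem map_star_omega₀ (x : V) : (G.omega₀ x).map star = (G.T₀ x).toBlocks₁₂ᴴ := rfl

theorem A₀_eq (x : V) : G.A₀ x = (G.T₀ x).toBlocks₂₂
    - (G.T₀ x).toBlocks₁₂ᴴ * pinv (G.T₀ x).toBlocks₁₁ * (G.T₀ x).toBlocks₁₂ := rfl

theorem IsExtension.diff_eq_zero {x : V} {v : Fin d → ℂ} {f : V → Fin d → ℂ}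
    (h : G.IsExtension x (Sum.elim v 0) f) : ∀ y ∈ G.nbr x, G.diff f x y = 0 := by
  intro y hy
  have := h.diff_eq G ⟨y, G.mem_sphere_one_iff_mem_nbr.2 hy⟩
  have hz : (fun j => (Sum.elim v 0 : G.IdxB x → ℂ)
      (Sum.inr (⟨y, G.mem_sphere_one_iff_mem_nbr.2 hy⟩, j))) = 0 := rfl
  rw [hz, Matrix.mulVec_zero, smul_zero] at this
  exact this

/-- A vector `(v, 0)` extends to a function covariantly constant on `B_1(x)`, where `Γ₂` is a sum of
squares. -/
theorem a₀_posSemidef (x : V) : (G.a₀ x).PosSemidef := by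
  have key : ∀ v w : Fin d → ℂ, ∃ f g, G.IsExtension x (Sum.elim v 0) f ∧
      G.IsExtension x (Sum.elim w 0) g ∧
      v ⬝ᵥ G.a₀ x *ᵥ star w = 2 * G.Gam2 f g x ∧ w ⬝ᵥ G.a₀ x *ᵥ star v = 2 * G.Gam2 g f x := by
    intro v w
    obtain ⟨f, hf, hfo⟩ := G.exists_isExtension x (Sum.elim v 0)
    obtain ⟨g, hg, hgo⟩ := G.exists_isExtension x (Sum.elim w 0)
    refine ⟨f, g, hf, hg, ?_, ?_⟩
    · rw [← G.dotProduct_twoBQB_mulVec hf hfo hg, Matrix.dotProduct_mulVec_toBlocks]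
      simp [a₀_eq, T₀]
    · rw [← G.dotProduct_twoBQB_mulVec hg hgo hf, Matrix.dotProduct_mulVec_toBlocks]
      simp [a₀_eq, T₀]
  refine Matrix.PosSemidef.of_dotProduct_mulVec_nonneg ?_ fun v => ?_
  · refine Matrix.ext_of_dotProduct_mulVec_star fun v w => ?_
    obtain ⟨f, g, -, -, h1, h2⟩ := key v w
    have h3 : v ⬝ᵥ (G.a₀ x)ᴴ *ᵥ star w = star (w ⬝ᵥ G.a₀ x *ᵥ star v) := by
      rw [← Matrix.star_vecMul, Matrix.dotProduct_mulVec]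
      exact Matrix.dotProduct_star _ _
    rw [h3, h1, h2, star_mul', star_Gam2]
    simp
  · obtain ⟨f, hf, hfo⟩ := G.exists_isExtension x (Sum.elim (star v) 0)
    have h1 : star v ⬝ᵥ G.a₀ x *ᵥ v = 2 * G.Gam2 f f x := by
      rw [← G.dotProduct_twoBQB_mulVec hf hfo hf, Matrix.dotProduct_mulVec_toBlocks]
      simp [a₀_eq, T₀]
    have h2 := G.Gam2_self_nonneg_of_diff_eq_zero (hf.diff_eq_zero G)
    have h3 : (2 : ℂ) * G.Gam2 f f x = (1 / 2 : ℂ) * (4 * G.Gam2 f f x) := by ring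
    rw [h1, h3]
    refine mul_nonneg ?_ h2
    simp

/-- Without first and second differences, `Γ₂(f,·)(x)` vanishes identically; in particular `f` is
critical and computes the whole row. -/
theorem vecMul_T₀_eq_zero {x : V} {v : Fin d → ℂ} {f : V → Fin d → ℂ}
    (hf : G.IsExtension x (Sum.elim v 0) f)
    (h : ∀ y ∈ G.nbr x, ∀ z ∈ G.nbr y, G.diff2 f x y z = 0) :
    v ᵥ* (G.T₀ x).toBlocks₁₁ = 0 ∧ v ᵥ* (G.T₀ x).toBlocks₁₂ = 0 := by
  have hΓ : ∀ g, G.Gam2 f g x = 0 := by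
    intro g
    have := G.four_Gam2_of_diff_eq_zero (hf.diff_eq_zero G) g
    rw [Finset.sum_eq_zero] at this
    · simpa using this
    · intro y hy
      rw [Finset.sum_eq_zero, mul_zero]
      intro z hz
      rw [h y hy z hz, zero_dotProduct, mul_zero]
  have hT : ∀ (c : Fin d → ℂ) (e : G.Idx1 x → ℂ),
      v ⬝ᵥ (G.T₀ x).toBlocks₁₁ *ᵥ star c + v ⬝ᵥ (G.T₀ x).toBlocks₁₂ *ᵥ star e = 0 := by
    intro c e
    obtain ⟨g, hg, -⟩ := G.exists_isExtension x (Sum.elim c e)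
    have := G.dotProduct_twoBQB_mulVec hf (fun g _ _ => hΓ g) hg
    rw [hΓ, mul_zero, Matrix.dotProduct_mulVec_toBlocks] at this
    simpa [T₀] using this
  constructor
  · rw [← dotProduct_eq_zero_iff]
    intro c
    have := hT (star c) 0
    simpa [Matrix.dotProduct_mulVec] using this
  · rw [← dotProduct_eq_zero_iff]
    intro e
    have := hT 0 (star e)
    simpa [Matrix.dotProduct_mulVec] using this

/-- `2 B₀QB₀ᴴ` itself need not be semidefinite, so this is not automatic. The point is that `v a =
0` gives `Γ₂(f,f)(x) = 0` for the critical extension, which forces all its second differences to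
vanish. -/
theorem vecMul_toBlocks₁₂_eq_zero (x : V) (v : Fin d → ℂ)
    (h : v ᵥ* (G.T₀ x).toBlocks₁₁ = 0) : v ᵥ* (G.T₀ x).toBlocks₁₂ = 0 := by
  obtain ⟨f, hf, hfo⟩ := G.exists_isExtension x (Sum.elim v 0)
  have h1 := G.dotProduct_twoBQB_mulVec hf hfo hf
  rw [Matrix.dotProduct_mulVec_toBlocks, Matrix.dotProduct_mulVec] at h1
  change v ᵥ* (G.T₀ x).toBlocks₁₁ ⬝ᵥ _ + _ + _ + _ = _ at h1
  rw [h] at h1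
  refine (G.vecMul_T₀_eq_zero hf (G.diff2_eq_zero_of_Gam2_self (hf.diff_eq_zero G) ?_)).2
  simpa using h1.symm

theorem toBlocks₁₁_mul_pinv_mul (x : V) : (G.T₀ x).toBlocks₁₁ *
    (pinv (G.T₀ x).toBlocks₁₁ * (G.T₀ x).toBlocks₁₂) = (G.T₀ x).toBlocks₁₂ :=
  mul_pinv_mul_of_vecMul_eq_zero (G.vecMul_toBlocks₁₂_eq_zero x)

end Blocks

end ConnectionGraph

namespace ConnectionGraph

/-! ### Balanced incomplete balls -/

section BalancedBall

variable {V : Type*} {d : ℕ} (G : ConnectionGraph V d)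

theorem mem_closedBall_two {x y z : V} (hy : y ∈ G.nbr x) (hz : z ∈ G.nbr y) :
    z ∈ G.closedBall x 2 := by
  have h1 : G.graph.Adj x y := G.mem_nbr.1 hy
  have h2 : G.graph.Adj y z := G.mem_nbr.1 hz
  exact SimpleGraph.edist_le (SimpleGraph.Walk.cons h1 (SimpleGraph.Walk.cons h2 .nil))

theorem incBall_adj {x : V} {u v : G.closedBall x 2} (h : v.1 ∈ G.nbr u.1)
    (hs : u.1 ∉ G.sphere x 2 ∨ v.1 ∉ G.sphere x 2) : (G.incBall x).graph.Adj u v := by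
  classical
  have hw : (G.incBall x).w u v = G.w u v := if_neg fun ⟨h1, h2⟩ => hs.elim (· h1) (· h2)
  have : (G.incBall x).w u v ≠ 0 := by rw [hw]; exact G.mem_nbr.1 h
  exact this

theorem σ_mul_σ_swap {x y : V} (h : y ∈ G.nbr x) : G.σ x y * G.σ y x = 1 := by
  rw [G.σ_inv x y (G.mem_nbr.1 h), inv_mul_cancel]

theorem σ_triangle_of_balanced {x : V} (hb : (G.incBall x).Balanced) {y z : V}
    (hy : y ∈ G.nbr x) (hz : z ∈ G.nbr x) (hyz : z ∈ G.nbr y) :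
    G.σ x y * G.σ y z = G.σ x z := by
  have hx' : x ∉ G.sphere x 2 := fun h => (G.mem_sphere_two.1 h).1 rfl
  have hs : ∀ {u}, u ∈ G.nbr x → u ∉ G.sphere x 2 := fun hu h => (G.mem_sphere_two.1 h).2.1 hu
  have mx : x ∈ G.closedBall x 2 := G.mem_closedBall_two hy (G.mem_nbr_comm.1 hy)
  have my : y ∈ G.closedBall x 2 := G.mem_closedBall_two hz (G.mem_nbr_comm.1 hyz)
  have mz : z ∈ G.closedBall x 2 := G.mem_closedBall_two hy hyz
  have a1 : (G.incBall x).graph.Adj ⟨x, mx⟩ ⟨y, my⟩ := G.incBall_adj hy (Or.inl hx')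
  have a2 : (G.incBall x).graph.Adj ⟨y, my⟩ ⟨z, mz⟩ := G.incBall_adj hyz (Or.inl (hs hy))
  have a3 : (G.incBall x).graph.Adj ⟨z, mz⟩ ⟨x, mx⟩ :=
    G.incBall_adj (G.mem_nbr_comm.1 hz) (Or.inr hx')
  have nxy : x ≠ y := fun e => G.self_notMem_nbr x (by rwa [← e] at hy)
  have nxz : x ≠ z := fun e => G.self_notMem_nbr x (by rwa [← e] at hz)
  have nyz : y ≠ z := fun e => G.self_notMem_nbr y (by rwa [← e] at hyz)
  have hcyc : (SimpleGraph.Walk.cons a1 (.cons a2 (.cons a3 .nil))).IsCycle := by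
    simp [SimpleGraph.Walk.cons_isCycle_iff, SimpleGraph.Walk.cons_isPath_iff, nxy, nxz, nyz,
      nxy.symm, nxz.symm]
  have h : G.σ x y * (G.σ y z * (G.σ z x * 1)) = 1 := hb _ _ hcyc
  rw [mul_one, ← mul_assoc, mul_eq_one_iff_eq_inv] at h
  rw [h, ← G.σ_inv x z (G.mem_nbr.1 hz)]

/-- Unless `y = y₀`, the closed walk `x, y, z, y₀, x` is a cycle, and none of its edges joins two
vertices of `S_2(x)`. -/
theorem σ_square_of_balanced {x : V} (hb : (G.incBall x).Balanced) {y y₀ z : V}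
    (hy : y ∈ G.nbr x) (hy₀ : y₀ ∈ G.nbr x) (hyz : z ∈ G.nbr y) (hy₀z : z ∈ G.nbr y₀)
    (hzx : z ≠ x) : G.σ x y * G.σ y z = G.σ x y₀ * G.σ y₀ z := by
  by_cases hyy : y = y₀
  · rw [hyy]
  have hx' : x ∉ G.sphere x 2 := fun h => (G.mem_sphere_two.1 h).1 rfl
  have hs : ∀ {u}, u ∈ G.nbr x → u ∉ G.sphere x 2 := fun hu h => (G.mem_sphere_two.1 h).2.1 hu
  have mx : x ∈ G.closedBall x 2 := G.mem_closedBall_two hy (G.mem_nbr_comm.1 hy)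
  have mz : z ∈ G.closedBall x 2 := G.mem_closedBall_two hy hyz
  have hn : ∀ {u}, u ∈ G.nbr x → u ∈ G.closedBall x 2 := fun {u} hu => by
    have h1 : G.graph.edist x u ≤ (1 : ℕ) :=
      G.sphere_subset_closedBall x 1 (G.mem_sphere_one_iff_mem_nbr.2 hu)
    exact h1.trans (by exact_mod_cast one_le_two)
  have a1 : (G.incBall x).graph.Adj ⟨x, mx⟩ ⟨y, hn hy⟩ := G.incBall_adj hy (Or.inl hx')
  have a2 : (G.incBall x).graph.Adj ⟨y, hn hy⟩ ⟨z, mz⟩ := G.incBall_adj hyz (Or.inl (hs hy))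
  have a3 : (G.incBall x).graph.Adj ⟨z, mz⟩ ⟨y₀, hn hy₀⟩ :=
    G.incBall_adj (G.mem_nbr_comm.1 hy₀z) (Or.inr (hs hy₀))
  have a4 : (G.incBall x).graph.Adj ⟨y₀, hn hy₀⟩ ⟨x, mx⟩ :=
    G.incBall_adj (G.mem_nbr_comm.1 hy₀) (Or.inr hx')
  have nxy : x ≠ y := fun e => G.self_notMem_nbr x (by rwa [← e] at hy)
  have nxy₀ : x ≠ y₀ := fun e => G.self_notMem_nbr x (by rwa [← e] at hy₀)
  have nyz : y ≠ z := fun e => G.self_notMem_nbr y (by rwa [← e] at hyz)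
  have ny₀z : y₀ ≠ z := fun e => G.self_notMem_nbr y₀ (by rwa [← e] at hy₀z)
  have hcyc : (SimpleGraph.Walk.cons a1 (.cons a2 (.cons a3 (.cons a4 .nil)))).IsCycle := by
    simp [SimpleGraph.Walk.cons_isCycle_iff, SimpleGraph.Walk.cons_isPath_iff, nxy, nxy₀, nyz,
      hzx, hyy, nxy.symm, nxy₀.symm, ny₀z.symm, hzx.symm]
  have h : G.σ x y * (G.σ y z * (G.σ z y₀ * (G.σ y₀ x * 1))) = 1 := hb _ _ hcyc
  rw [mul_one, ← mul_assoc, mul_eq_one_iff_eq_inv] at h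
  rw [h, mul_inv_rev, ← G.σ_inv x y₀ (G.mem_nbr.1 hy₀), ← G.σ_inv y₀ z (G.mem_nbr.1 hy₀z)]

/-- Transport from `x` along a path of length at most two; triangles and squares make it independent
of the path. Outside `B_2(x)` the value is a dummy. -/
theorem exists_potential_of_balanced {x : V} (hb : (G.incBall x).Balanced) :
    ∃ τ : V → Matrix.unitaryGroup (Fin d) ℂ, τ x = 1 ∧ (∀ y ∈ G.nbr x, τ y = G.σ x y) ∧
      ∀ y ∈ G.nbr x, ∀ z ∈ G.nbr y, τ z = G.σ x y * G.σ y z := by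
  classical
  refine ⟨fun z => if z = x then 1 else if z ∈ G.nbr x then G.σ x z else
    if h : ∃ y ∈ G.nbr x, z ∈ G.nbr y then G.σ x h.choose * G.σ h.choose z else 1, ?_, ?_, ?_⟩
  · simp
  · intro y hy
    have : y ≠ x := fun e => G.self_notMem_nbr x (by rwa [e] at hy)
    simp [this, hy]
  · intro y hy z hz
    by_cases h0 : z = x
    · subst h0
      simp [G.σ_mul_σ_swap hy]
    by_cases h1 : z ∈ G.nbr x
    · simp [h0, h1, G.σ_triangle_of_balanced hb hy h1 hz]
    · have h : ∃ y ∈ G.nbr x, z ∈ G.nbr y := ⟨y, hy, hz⟩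
      simp only [h0, h1, h, dif_pos, if_false]
      exact (G.σ_square_of_balanced hb hy h.choose_spec.1 hz h.choose_spec.2 h0).symm

/-- Every `v` spreads through the potential to a function with no first or second differences at
`x`. -/
theorem T₀_of_balanced {x : V} (hb : (G.incBall x).Balanced) :
    (G.T₀ x).toBlocks₁₁ = 0 ∧ (G.T₀ x).toBlocks₁₂ = 0 := by
  obtain ⟨τ, h0, h1, h2⟩ := G.exists_potential_of_balanced hb
  have hu : ∀ U : Matrix.unitaryGroup (Fin d) ℂ,
      (U : Matrix (Fin d) (Fin d) ℂ) * (U : Matrix (Fin d) (Fin d) ℂ)ᴴ = 1 :=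
    fun U => Matrix.mem_unitaryGroup_iff.1 U.2
  have key : ∀ v : Fin d → ℂ,
      v ᵥ* (G.T₀ x).toBlocks₁₁ = 0 ∧ v ᵥ* (G.T₀ x).toBlocks₁₂ = 0 := by
    intro v
    set f : V → Fin d → ℂ := fun z => (τ z : Matrix (Fin d) (Fin d) ℂ)ᴴ *ᵥ v with hf
    have hfx : f x = v := by simp [hf, h0]
    have hfy : ∀ y ∈ G.nbr x, (G.σ x y : Matrix (Fin d) (Fin d) ℂ) *ᵥ f y = v := by
      intro y hy
      rw [hf]
      simp only
      rw [h1 y hy, Matrix.mulVec_mulVec, hu, Matrix.one_mulVec]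
    have hfz : ∀ y ∈ G.nbr x, ∀ z ∈ G.nbr y, (G.σ x y : Matrix (Fin d) (Fin d) ℂ) *ᵥ
        (G.σ y z : Matrix (Fin d) (Fin d) ℂ) *ᵥ f z = v := by
      intro y hy z hz
      have : (G.σ x y : Matrix (Fin d) (Fin d) ℂ) * (G.σ y z : Matrix (Fin d) (Fin d) ℂ)
        = ((G.σ x y * G.σ y z : Matrix.unitaryGroup (Fin d) ℂ) : Matrix (Fin d) (Fin d) ℂ) := rfl
      rw [hf, Matrix.mulVec_mulVec]
      simp only
      rw [h2 y hy z hz, Matrix.mulVec_mulVec, this, hu, Matrix.one_mulVec]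
    have hext : G.IsExtension x (Sum.elim v 0) f := by
      refine ⟨hfx, fun y => ?_⟩
      have hz : (fun j => (Sum.elim v 0 : G.IdxB x → ℂ) (Sum.inr (y, j))) = 0 := rfl
      rw [hz, smul_zero, add_zero, hf]
      simp only
      rw [h1 y (G.mem_sphere_one_iff_mem_nbr.1 y.2)]
      rfl
    refine G.vecMul_T₀_eq_zero hext fun y hy z hz => ?_
    simp only [diff2, diff, Matrix.mulVec_sub, hfz y hy z hz, hfy y hy, hfx, sub_self]
  constructor
  · ext i j
    simpa using congrFun (key (Pi.single i 1)).1 j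
  · ext i j
    simpa using congrFun (key (Pi.single i 1)).2 j

end BalancedBall

end ConnectionGraph

namespace ConnectionGraph

/-! ### Curvature matrices of the product -/

section ProductBlocks

variable {V V' : Type*} {d : ℕ} (G : ConnectionGraph V d) (G' : ConnectionGraph V' d)
  (α β : ℝ) (hα : 0 < α) (hβ : 0 < β)

/-- The identification of the block index sets of `B_1((x,x'))`. -/
noncomputable def idxBProdEquiv (x : V) (x' : V') :
    Fin d ⊕ (G.Idx1 x ⊕ G'.Idx1 x') ≃ (G.prod G' α β hα hβ).IdxB (x, x') :=
  (Equiv.refl _).sumCongr (G.idxProdEquiv G' α β hα hβ x x')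

/-- Rates in the product are `αp` and `βp'`, so the diagonal of `B₀` acquires the factors `1/√α` and
`1/√β`. -/
theorem IsExtension.prod {x : V} {x' : V'} {v₀ : Fin d → ℂ} {v : G.Idx1 x → ℂ}
    {v' : G'.Idx1 x' → ℂ} {F : V × V' → Fin d → ℂ}
    (h : G.IsExtension x (Sum.elim v₀ (((1 / √α : ℝ) : ℂ) • v)) fun y => F (y, x'))
    (h' : G'.IsExtension x' (Sum.elim v₀ (((1 / √β : ℝ) : ℂ) • v')) fun y' => F (x, y')) :
    (G.prod G' α β hα hβ).IsExtension (x, x')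
      (Sum.elim v₀ (Sum.elim v v') ∘ (G.idxBProdEquiv G' α β hα hβ x x').symm) F := by
  have hinr : ∀ q, (Sum.elim v₀ (Sum.elim v v') ∘ (G.idxBProdEquiv G' α β hα hβ x x').symm)
      (Sum.inr (G.idxProdEquiv G' α β hα hβ x x' q)) = Sum.elim v v' q := fun q => by
    simp [idxBProdEquiv]
  refine ⟨h.at_center, fun u => ?_⟩
  obtain ⟨y | y', rfl⟩ := (sphereProdMap_bijective G G' α β hα hβ x x').2 u
  · have h1 : (fun j => (Sum.elim v₀ (Sum.elim v v') ∘
        (G.idxBProdEquiv G' α β hα hβ x x').symm)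
        (Sum.inr (sphereProdMap G G' α β hα hβ x x' (Sum.inl y), j))) = fun j => v (y, j) :=
      funext fun j => hinr (Sum.inl (y, j))
    rw [h1]
    simp only [sphereProdMap, Sum.elim_inl]
    rw [p_prod_left, σ_prod_left]
    have e := h.at_nbr y
    rw [e]
    refine congrArg₂ _ rfl (funext fun j => ?_)
    rw [Real.sqrt_mul hα.le]
    simp only [Pi.smul_apply, Sum.elim_inr, smul_eq_mul]
    push_cast
    field_simp
  · have h1 : (fun j => (Sum.elim v₀ (Sum.elim v v') ∘
        (G.idxBProdEquiv G' α β hα hβ x x').symm)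
        (Sum.inr (sphereProdMap G G' α β hα hβ x x' (Sum.inr y'), j))) = fun j => v' (y', j) :=
      funext fun j => hinr (Sum.inr (y', j))
    rw [h1]
    simp only [sphereProdMap, Sum.elim_inr]
    rw [p_prod_right, σ_prod_right _ _ _ _ _ _ _ (G'.mem_sphere_one_iff_mem_nbr.1 y'.2)]
    have e := h'.at_nbr y'
    rw [e]
    refine congrArg₂ _ rfl (funext fun j => ?_)
    rw [Real.sqrt_mul hβ.le]
    simp only [Pi.smul_apply, Sum.elim_inr, smul_eq_mul]
    push_cast
    field_simp

theorem dotProduct_T₀_prod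
    (hcomm : ∀ x y, y ∈ G.nbr x → ∀ x' y', y' ∈ G'.nbr x' →
      G.σ x y * G'.σ x' y' = G'.σ x' y' * G.σ x y)
    (x : V) (x' : V') (v₀ w₀ : Fin d → ℂ) (v w : G.Idx1 x → ℂ) (v' w' : G'.Idx1 x' → ℂ) :
    Sum.elim v₀ (Sum.elim v v') ⬝ᵥ
      (((G.prod G' α β hα hβ).T₀ (x, x')).submatrix (G.idxBProdEquiv G' α β hα hβ x x')
        (G.idxBProdEquiv G' α β hα hβ x x')) *ᵥ star (Sum.elim w₀ (Sum.elim w w'))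
    = α ^ 2 * (Sum.elim v₀ (((1 / √α : ℝ) : ℂ) • v) ⬝ᵥ
        G.T₀ x *ᵥ star (Sum.elim w₀ (((1 / √α : ℝ) : ℂ) • w)))
      + β ^ 2 * (Sum.elim v₀ (((1 / √β : ℝ) : ℂ) • v') ⬝ᵥ
        G'.T₀ x' *ᵥ star (Sum.elim w₀ (((1 / √β : ℝ) : ℂ) • w'))) := by
  obtain ⟨f, hf, hfo⟩ := G.exists_isExtension x (Sum.elim v₀ (((1 / √α : ℝ) : ℂ) • v))
  obtain ⟨f', hf', hfo'⟩ := G'.exists_isExtension x' (Sum.elim v₀ (((1 / √β : ℝ) : ℂ) • v'))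
  obtain ⟨g, hg, hgo⟩ := G.exists_isExtension x (Sum.elim w₀ (((1 / √α : ℝ) : ℂ) • w))
  obtain ⟨g', hg', hgo'⟩ := G'.exists_isExtension x' (Sum.elim w₀ (((1 / √β : ℝ) : ℂ) • w'))
  obtain ⟨F, hF, hF', hFo, hFG⟩ := exists_isOptimalAt_prod G G' α β hα hβ hcomm
    (hf.at_center.trans hf'.at_center.symm) hfo hfo'
  -- Of `H` only its two slices are needed; criticality is used on the `F` side alone.
  obtain ⟨H, hH, hH', -, -⟩ := exists_isOptimalAt_prod G G' α β hα hβ hcomm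
    (hg.at_center.trans hg'.at_center.symm) hgo hgo'
  rw [← funext hF] at hf
  rw [← funext hF'] at hf'
  have hgH := hg
  have hgH' := hg'
  rw [← funext hH] at hgH
  rw [← funext hH'] at hgH'
  have key := (G.prod G' α β hα hβ).dotProduct_twoBQB_mulVec
    (IsExtension.prod G G' α β hα hβ hf hf') hFo (IsExtension.prod G G' α β hα hβ hgH hgH')
  rw [funext hF] at hf
  rw [funext hF'] at hf'
  rw [hFG, funext hH, funext hH', ← G.dotProduct_twoBQB_mulVec hf hfo hg,
    ← G'.dotProduct_twoBQB_mulVec hf' hfo' hg'] at key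
  rw [Matrix.submatrix_mulVec_equiv, ← comp_equiv_symm_dotProduct]
  exact key

/-- The weight `α²` meets one factor `1/√α` for each `S_1` argument, which gives the powers `α²`,
`α^{3/2}` and `α`; likewise for `β`. -/
theorem T₀_prod_blocks
    (hcomm : ∀ x y, y ∈ G.nbr x → ∀ x' y', y' ∈ G'.nbr x' →
      G.σ x y * G'.σ x' y' = G'.σ x' y' * G.σ x y) (x : V) (x' : V') :
    ((G.prod G' α β hα hβ).T₀ (x, x')).toBlocks₁₁
      = ((α ^ 2 : ℝ) : ℂ) • (G.T₀ x).toBlocks₁₁ + ((β ^ 2 : ℝ) : ℂ) • (G'.T₀ x').toBlocks₁₁ ∧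
    ((G.prod G' α β hα hβ).T₀ (x, x')).toBlocks₁₂.submatrix id
        (G.idxProdEquiv G' α β hα hβ x x')
      = Matrix.fromCols (((α ^ (3 / 2 : ℝ) : ℝ) : ℂ) • (G.T₀ x).toBlocks₁₂)
        (((β ^ (3 / 2 : ℝ) : ℝ) : ℂ) • (G'.T₀ x').toBlocks₁₂) ∧
    ((G.prod G' α β hα hβ).T₀ (x, x')).toBlocks₂₂.submatrix
        (G.idxProdEquiv G' α β hα hβ x x') (G.idxProdEquiv G' α β hα hβ x x')
      = Matrix.fromBlocks ((α : ℂ) • (G.T₀ x).toBlocks₂₂) 0 0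
        ((β : ℂ) • (G'.T₀ x').toBlocks₂₂) := by
  have hr : ∀ {r : ℝ}, 0 < r → r ^ 2 * (1 / √r) = r ^ (3 / 2 : ℝ) := by
    intro r h
    rw [Real.sqrt_eq_rpow, one_div, ← Real.rpow_neg h.le, ← Real.rpow_natCast,
      ← Real.rpow_add h]
    norm_num
  have hr2 : ∀ {r : ℝ}, 0 < r → r ^ 2 * (1 / √r * (1 / √r)) = r := by
    intro r h
    rw [div_mul_div_comm, Real.mul_self_sqrt h.le]
    field_simp
  have key := dotProduct_T₀_prod G G' α β hα hβ hcomm x x'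
  set S := ((G.prod G' α β hα hβ).T₀ (x, x')).submatrix (G.idxBProdEquiv G' α β hα hβ x x')
        (G.idxBProdEquiv G' α β hα hβ x x') with hS
  have h11 : ((G.prod G' α β hα hβ).T₀ (x, x')).toBlocks₁₁ = S.toBlocks₁₁ := rfl
  have h12 : ((G.prod G' α β hα hβ).T₀ (x, x')).toBlocks₁₂.submatrix id
        (G.idxProdEquiv G' α β hα hβ x x') = S.toBlocks₁₂ := rfl
  have h22 : ((G.prod G' α β hα hβ).T₀ (x, x')).toBlocks₂₂.submatrix
        (G.idxProdEquiv G' α β hα hβ x x') (G.idxProdEquiv G' α β hα hβ x x')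
      = S.toBlocks₂₂ := rfl
  rw [h11, h12, h22]
  refine ⟨?_, ?_, ?_⟩
  · refine Matrix.ext_of_dotProduct_mulVec_star fun v w => ?_
    have := key v w 0 0 0 0
    simp only [Matrix.dotProduct_mulVec_toBlocks] at this
    simp only [smul_zero, Sum.elim_zero_zero, star_zero, Matrix.mulVec_zero, dotProduct_zero,
      zero_dotProduct, add_zero] at this
    rw [this, Matrix.add_mulVec, dotProduct_add, Matrix.smul_mulVec, Matrix.smul_mulVec,
      dotProduct_smul, dotProduct_smul]
    simp
  · refine Matrix.ext_of_dotProduct_mulVec_star fun v w => ?_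
    obtain ⟨w, w', rfl⟩ : ∃ a b, w = Sum.elim a b :=
      ⟨_, _, (Sum.elim_comp_inl_inr w).symm⟩
    have := key v 0 0 w 0 w'
    have hs : star (Sum.elim w w') = Sum.elim (star w) (star w') := by
      ext (i | i) <;> rfl
    simp only [Matrix.dotProduct_mulVec_toBlocks] at this
    simp only [smul_zero, Sum.elim_zero_zero, star_zero, Matrix.mulVec_zero, dotProduct_zero,
      zero_dotProduct, add_zero, zero_add, star_smul, RCLike.star_def, Complex.conj_ofReal,
      Matrix.mulVec_smul, dotProduct_smul, smul_eq_mul] at this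
    rw [this, hs, Matrix.fromCols_mulVec_sumElim, dotProduct_add, Matrix.smul_mulVec,
      Matrix.smul_mulVec, dotProduct_smul, dotProduct_smul, ← hr hα, ← hr hβ]
    push_cast
    simp only [smul_eq_mul]
    ring
  · refine Matrix.ext_of_dotProduct_mulVec_star fun v w => ?_
    obtain ⟨w, w', rfl⟩ : ∃ a b, w = Sum.elim a b :=
      ⟨_, _, (Sum.elim_comp_inl_inr w).symm⟩
    obtain ⟨v, v', rfl⟩ : ∃ a b, v = Sum.elim a b :=
      ⟨_, _, (Sum.elim_comp_inl_inr v).symm⟩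
    have := key 0 0 v w v' w'
    simp only [Matrix.dotProduct_mulVec_toBlocks] at this
    simp only [star_zero, Matrix.mulVec_zero, dotProduct_zero,
      zero_dotProduct, add_zero, zero_add, star_smul, RCLike.star_def, Complex.conj_ofReal,
      Matrix.mulVec_smul, dotProduct_smul, smul_dotProduct, smul_eq_mul] at this
    rw [Matrix.dotProduct_mulVec_toBlocks (Matrix.fromBlocks _ _ _ _), Matrix.toBlocks_fromBlocks₁₁,
      Matrix.toBlocks_fromBlocks₁₂, Matrix.toBlocks_fromBlocks₂₁, Matrix.toBlocks_fromBlocks₂₂,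
      Matrix.smul_mulVec, Matrix.smul_mulVec, dotProduct_smul, dotProduct_smul,
      Matrix.zero_mulVec, Matrix.zero_mulVec, dotProduct_zero, dotProduct_zero, add_zero, add_zero]
    have ea : (α : ℂ) ^ 2 * (((1 / √α : ℝ) : ℂ) * ((1 / √α : ℝ) : ℂ)) = α := by
      exact_mod_cast hr2 hα
    have eb : (β : ℂ) ^ 2 * (((1 / √β : ℝ) : ℂ) * ((1 / √β : ℝ) : ℂ)) = β := by
      exact_mod_cast hr2 hβ
    rw [Matrix.dotProduct_mulVec_toBlocks S.toBlocks₂₂, this, smul_eq_mul, smul_eq_mul]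
    linear_combination (v ⬝ᵥ (G.T₀ x).toBlocks₂₂ *ᵥ star w) * ea
      + (v' ⬝ᵥ (G'.T₀ x').toBlocks₂₂ *ᵥ star w') * eb

/-- Absorbing the scalars into the blocks puts the remainder in the shape of
`posSemidef_schur_defect`. -/
theorem remainder_eq (x : V) (x' : V') (hα : 0 < α) (hβ : 0 < β) :
    let A := ((α ^ 2 : ℝ) : ℂ) • (G.T₀ x).toBlocks₁₁
    let A' := ((β ^ 2 : ℝ) : ℂ) • (G'.T₀ x').toBlocks₁₁
    let B := ((α ^ (3 / 2 : ℝ) : ℝ) : ℂ) • (G.T₀ x).toBlocks₁₂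
    let B' := ((β ^ (3 / 2 : ℝ) : ℝ) : ℂ) • (G'.T₀ x').toBlocks₁₂
    G.remainder G' α β x x' =
      Matrix.fromBlocks (Bᴴ * (pinv A - pinv (A + A')) * B) (-(Bᴴ * pinv (A + A') * B'))
      (-(B'ᴴ * pinv (A + A') * B)) (B'ᴴ * (pinv A' - pinv (A + A')) * B') := by
  intro A A' B B'
  have hr : ∀ {r : ℝ}, 0 < r → ((r ^ 3 : ℝ) : ℂ)
      = ((r ^ (3 / 2 : ℝ) : ℝ) : ℂ) * ((r ^ (3 / 2 : ℝ) : ℝ) : ℂ) := by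
    intro r h
    rw [← Complex.ofReal_mul, ← Real.rpow_add h, ← Real.rpow_natCast]
    norm_num
  simp only [remainder, map_star_omega₀]
  simp only [a₀_eq, omega₀_eq, Matrix.transpose_transpose, B, B', A, A',
    Matrix.conjTranspose_smul, Matrix.smul_mul, Matrix.mul_smul, smul_smul, hr hα, hr hβ,
    RCLike.star_def, Complex.conj_ofReal, Complex.ofReal_mul]
  rw [mul_comm ((β ^ (3 / 2 : ℝ) : ℝ) : ℂ) ((α ^ (3 / 2 : ℝ) : ℝ) : ℂ)]

theorem A₀_prod
    (hcomm : ∀ x y, y ∈ G.nbr x → ∀ x' y', y' ∈ G'.nbr x' →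
      G.σ x y * G'.σ x' y' = G'.σ x' y' * G.σ x y) (x : V) (x' : V') :
    ((G.prod G' α β hα hβ).A₀ (x, x')).submatrix
        (G.idxProdEquiv G' α β hα hβ x x') (G.idxProdEquiv G' α β hα hβ x x')
      = Matrix.fromBlocks ((α : ℂ) • G.A₀ x) 0 0 ((β : ℂ) • G'.A₀ x')
        + G.remainder G' α β x x' := by
  obtain ⟨h11, h12, h22⟩ := T₀_prod_blocks G G' α β hα hβ hcomm x x'
  -- The `(α²a)†` term of the remainder carries `α³ · α⁻² = α`, which matches the Schur correction
  -- inside `αA_∞(x)`.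
  have hr : ∀ {r : ℝ}, 0 < r → ((r ^ (3 / 2 : ℝ) : ℝ) : ℂ)
      * (((r ^ 2 : ℝ) : ℂ)⁻¹ * ((r ^ (3 / 2 : ℝ) : ℝ) : ℂ)) = (r : ℂ) := by
    intro r h
    rw [mul_comm ((r ^ 2 : ℝ) : ℂ)⁻¹, ← mul_assoc, ← Complex.ofReal_mul,
      ← Complex.ofReal_inv, ← Complex.ofReal_mul, ← Real.rpow_add h,
      ← Real.rpow_natCast, ← Real.rpow_neg h.le, ← Real.rpow_add h]
    norm_num
  have hα2 : ((α ^ 2 : ℝ) : ℂ) ≠ 0 := by exact_mod_cast (pow_pos hα 2).ne'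
  have hβ2 : ((β ^ 2 : ℝ) : ℂ) ≠ 0 := by exact_mod_cast (pow_pos hβ 2).ne'
  have hsub : ∀ (M : Matrix ((G.prod G' α β hα hβ).Idx1 (x, x')) (Fin d) ℂ)
      (P : Matrix (Fin d) (Fin d) ℂ) (N : Matrix (Fin d) ((G.prod G' α β hα hβ).Idx1 (x, x')) ℂ),
      (M * P * N).submatrix (G.idxProdEquiv G' α β hα hβ x x')
        (G.idxProdEquiv G' α β hα hβ x x')
      = M.submatrix (G.idxProdEquiv G' α β hα hβ x x') id * P
        * N.submatrix id (G.idxProdEquiv G' α β hα hβ x x') := fun _ _ _ => rfl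
  rw [remainder_eq G G' α β x x' hα hβ, A₀_eq, Matrix.submatrix_sub, Pi.sub_apply,
    Pi.sub_apply, hsub,
    ← Matrix.conjTranspose_submatrix, h11, h12, h22,
    Matrix.conjTranspose_fromCols_eq_fromRows_conjTranspose, Matrix.fromRows_mul,
    Matrix.fromRows_mul_fromCols, Matrix.fromBlocks_add, sub_eq_iff_eq_add,
    Matrix.fromBlocks_add, A₀_eq, A₀_eq, pinv_smul hα2, pinv_smul hβ2]
  refine congr (congr (congr (congrArg _ ?_) ?_) ?_) ?_
  · simp only [Matrix.mul_sub, Matrix.sub_mul, Matrix.conjTranspose_smul, Matrix.smul_mul,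
      Matrix.mul_smul, smul_smul, RCLike.star_def, Complex.conj_ofReal, smul_sub, hr hα]
    abel
  · abel
  · abel
  · simp only [Matrix.mul_sub, Matrix.sub_mul, Matrix.conjTranspose_smul, Matrix.smul_mul,
      Matrix.mul_smul, smul_smul, RCLike.star_def, Complex.conj_ofReal, smul_sub, hr hβ]
    abel

theorem remainder_posSemidef (hα : 0 < α) (hβ : 0 < β) (x : V) (x' : V') :
    (G.remainder G' α β x x').PosSemidef := by
  have hsmul : ∀ {M : Matrix (Fin d) (Fin d) ℂ} {r : ℝ}, 0 < r → M.PosSemidef →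
      (((r ^ 2 : ℝ) : ℂ) • M).PosSemidef := fun {M r} h hM =>
    hM.smul (by exact_mod_cast (pow_pos h 2).le)
  rw [remainder_eq G G' α β x x' hα hβ]
  have hα2 : ((α ^ 2 : ℝ) : ℂ) ≠ 0 := by exact_mod_cast (pow_pos hα 2).ne'
  have hβ2 : ((β ^ 2 : ℝ) : ℂ) ≠ 0 := by exact_mod_cast (pow_pos hβ 2).ne'
  refine posSemidef_schur_defect (hsmul hα (G.a₀_posSemidef x)) (hsmul hβ (G'.a₀_posSemidef x'))
    ?_ ?_
  · rw [pinv_smul hα2]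
    simp only [Matrix.mul_smul, Matrix.smul_mul, smul_smul, G.toBlocks₁₁_mul_pinv_mul x,
      mul_assoc, inv_mul_cancel₀ hα2, mul_one]
  · rw [pinv_smul hβ2]
    simp only [Matrix.mul_smul, Matrix.smul_mul, smul_smul, G'.toBlocks₁₁_mul_pinv_mul x',
      mul_assoc, inv_mul_cancel₀ hβ2, mul_one]

/-- Once `a = 0` and `ω = 0`, the blocks containing `ω` vanish and the remaining corner is a
difference of two equal pseudoinverses. -/
theorem remainder_eq_zero_of_balanced {x : V} {x' : V'}
    (h : (G.incBall x).Balanced ∨ (G'.incBall x').Balanced) :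
    G.remainder G' α β x x' = 0 := by
  rcases h with h | h
  · obtain ⟨h1, h2⟩ := G.T₀_of_balanced h
    simp [remainder, a₀_eq, omega₀_eq, h1, h2]
  · obtain ⟨h1, h2⟩ := G'.T₀_of_balanced h
    simp [remainder, a₀_eq, omega₀_eq, h1, h2]

end ProductBlocks

end ConnectionGraph

theorem mainTheorem6 {V V' : Type*} {d : ℕ}
    (G : ConnectionGraph V d) (G' : ConnectionGraph V' d)
    (hcomm : ∀ g ∈ G.signatureGroup, ∀ g' ∈ G'.signatureGroup, g * g' = g' * g)
    (α β : ℝ) (hα : 0 < α) (hβ : 0 < β) (x : V) (x' : V') :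
    ((G.prod G' α β hα hβ).A₀ (x, x')).submatrix
        (G.idxProdEquiv G' α β hα hβ x x') (G.idxProdEquiv G' α β hα hβ x x')
      = Matrix.fromBlocks ((α : ℂ) • G.A₀ x) 0 0 ((β : ℂ) • G'.A₀ x')
        + G.remainder G' α β x x'
    ∧ (G.remainder G' α β x x').PosSemidef
    ∧ ((G.incBall x).Balanced ∨ (G'.incBall x').Balanced →
        G.remainder G' α β x x' = 0) := by
  refine ⟨G.A₀_prod G' α β hα hβ (fun u y hy u' y' hy' => ?_) x x',
    G.remainder_posSemidef G' α β hα hβ x x',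
    G.remainder_eq_zero_of_balanced G' α β⟩
  exact hcomm _ (Subgroup.subset_closure ⟨u, y, G.mem_nbr.1 hy, rfl⟩) _
    (Subgroup.subset_closure ⟨u', y', G'.mem_nbr.1 hy', rfl⟩)
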